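/- **Setting.** Let $\mathcal T$ be a perfect binary tree of depth $L$ whose leaves carry consecutive index vectors $I_\alpha$ that together form $[1,\dots,n]$; a non-leaf node carries the concatenation of the index vectors of its two children, and $|\tau|$ is the length of the index vector $I_\tau$ of $\tau$. For matrices $\{C_\tau\}$ attached to the nodes let $\mathbf C^{(\ell)}=\mathrm{blkdiag}(C_\tau:\operatorname{depth}\tau=\ell)$. A matrix $A\in\mathbb R^{n\times n}$ is an *HSS matrix of rank $\rho$* for $\mathcal T$ if there are matrices $U^{\rm big}_\tau,V^{\rm big}_\tau\in\mathbb R^{|\tau|\times \rho}$ (with orthonormal columns for all non-root $\tau$) such that $A_{\tau,\tau'}=U^{\rm big}_\tau\tilde A_{\tau,\tau'}(V^{\rm big}_{\tau'})^T$ with some $\tilde A_{\tau,\tau'}\in\mathbb R^{\rho\times\rho}$ for all siblings $\tau,\tau'$, and, for every non-leaf $\tau$ with children $\alpha,\beta$, $U^{\rm big}_\tau=\mathrm{blkdiag}(U^{\rm big}_\alpha,U^{\rm big}_\beta)U_\tau$ and $V^{\rm big}_\tau=\mathrm{blkdiag}(V^{\rm big}_\alpha,V^{\rm big}_\beta)V_\tau$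 with some $U_\tau,V_\tau\in\mathbb R^{2\rho\times \rho}$ with orthonormal columns. A *symmetric telescopic decomposition* $\{U_\tau,D_\tau\}_{\tau\in\mathcal T}$ of $A$ consists of symmetric $D_\tau$ (all $\tau$) and $U_\tau$ with orthonormal columns ($\tau$ not the root) such that, with $A^{(0)}:=D_{\rm root}$ and $A^{(\ell)}:=\mathbf D^{(\ell)}+\mathbf U^{(\ell)}A^{(\ell-1)}(\mathbf U^{(\ell)})^T$ for $1\le \ell\le L$, one has $A=A^{(L)}$. Here $U_\tau$ has $m_\tau$ columns (all $m_\tau$ are equal if the decomposition has a constant telescopic rank), and the number of rows of $U_\tau$ and $D_\tau$ is $|\tau|$ for a leaf and $m_\alpha+m_\beta$ for a node with children $\alpha,\beta$. It is *standard* if, for every $\ell\le L$ and every $\tau$ of depth $\ell$, $D_\tau$ is the diagonal block of $A^{(\ell)}$ at $\tau$. Let $\xi=(\xi_0,\dots,\xi_{k-1})$, $\xi_j\in\mathbb C\cup\{\infty\}$, be a list of poles closed (with multiplicities) under complex conjugation, and put $q_k(x)=\prod_{\xi_j\ne\infty}(x-\xi_j)$. For $M\in\mathbb R^{m\times m}$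 and $B\in\mathbb R^{m\times b}$, such that no $\xi_j$ is an eigenvalue of $M$, let $\mathcal Q(M,B,\xi)=\{q_k(M)^{-1}\sum_{j=0}^{k-1}M^jBK_j: K_j\in\mathbb R^{b\times b}\}$; an orthonormal basis of it is a matrix with orthonormal columns whose column space is spanned by the columns of the elements of $\mathcal Q(M,B,\xi)$. **Algorithm.** Given $\{U_\tau,D_\tau\}$, $f$ and $\xi$, process the nodes $\tau$ from the leaves to the root. For a leaf put $\tilde D_\tau=D_\tau$ and (if $\tau$ is not the root) $Z_\tau=U_\tau$. For a node $\tau$ with children $\alpha,\beta$ put $E_\tau=\mathrm{blkdiag}(W_\alpha^TZ_\alpha,W_\beta^TZ_\beta)$, $\tilde D_\tau=\mathrm{blkdiag}(W_\alpha^T\tilde D_\alpha W_\alpha,W_\beta^T\tilde D_\beta W_\beta)+E_\tau D_\tau E_\tau^T$ and (if $\tau$ is not the root) $Z_\tau=E_\tau U_\tau$. If $\tau$ is not the root, let $W_\tau$ be an orthonormal basis of $\mathcal Q(\tilde D_\tau,Z_\tau,\xi)$ (it is required that no pole is an eigenvalue of $\tilde D_\tau$) and put $C_\tau=f(\tilde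 D_\tau)-W_\tau f(W_\tau^T\tilde D_\tau W_\tau)W_\tau^T$; for the root put $C_\tau=f(\tilde D_\tau)$. The output is the matrix $F=F^{(L)}$ generated by $\{W_\tau,C_\tau\}$, that is, $F^{(0)}=C_{\rm root}$ and $F^{(\ell)}=\mathbf C^{(\ell)}+\mathbf W^{(\ell)}F^{(\ell-1)}(\mathbf W^{(\ell)})^T$ for $1\le\ell\le L$. **Theorem.** Let $A\in\mathbb R^{n\times n}$ be a symmetric HSS matrix for a cluster tree $\mathcal T$ of depth $L$, and let $\{U_\tau,D_\tau\}$ be a standard symmetric telescopic decomposition of $A$. Let $f$ be a real function that is analytic on an interval $[\lambda_{\min},\lambda_{\max}]$ containing the eigenvalues of $A$. Then every output $F$ of the algorithm applied to $\{U_\tau,D_\tau\}$, $f$ and $\xi$ satisfies $$\|f(A)-F\|_2\le 4L\min_{r\in\mathbb P_k/q_k}\|f-r\|_\infty ,$$ where $\mathbb P_k$ is the set of (complex) polynomials of degree at most $k-1$, $\|\cdot\|_\infty$ is the supremum norm on $[\lambda_{\min},\lambda_{\max}]$, and the minimum is attained. In particular $F=f(A)$ if $f$ coincides on $[\lambda_{\min},\lambda_{\max}]$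 with an element of $\mathbb P_k/q_k$. -/

import Mathlib

open Polynomial

noncomputable section

namespace HSSFun

/-! ### Cluster trees

The nodes of depth `ℓ` of a perfect binary tree are numbered from left to right by `Fin (2 ^ ℓ)`. -/

/-- The children (`b = 0` left, `b = 1` right) of a node; `child τ b` has number `2 τ + b`. -/
def child {ℓ : ℕ} (τ : Fin (2 ^ ℓ)) (b : Fin 2) : Fin (2 ^ (ℓ + 1)) :=
  finProdFinEquiv (τ, b)

/-- A cluster tree of depth `L` for the indices `0, …, n - 1`, given by the lengths of the
consecutive index vectors that belong to its leaves. -/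
structure ClusterTree (n L : ℕ) where
  leafSize : Fin (2 ^ L) → ℕ
  sum_leafSize : ∑ τ, leafSize τ = n

/-- Pairs (block number, position inside the block) for blocks of sizes `s τ`. -/
abbrev BlockIdx {N : ℕ} (s : Fin N → ℕ) : Type := Σ τ : Fin N, Fin (s τ)

/-- Position `i` in leaf `τ` is the index `(∑ σ < τ, |σ|) + i`. -/
def ClusterTree.enum {n L : ℕ} (T : ClusterTree n L) : BlockIdx T.leafSize ≃ Fin n :=
  finSigmaFinEquiv.trans (finCongr T.sum_leafSize)

/-- The index set `I_τ` of a node `τ` of depth `ℓ ≤ L`: all indices that belong to leaves below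
`τ`. The leaf number `σ` lies below `τ` iff `⌊σ / 2 ^ (L - ℓ)⌋ = τ`. -/
def ClusterTree.cluster {n L : ℕ} (T : ClusterTree n L) (ℓ : ℕ) (τ : Fin (2 ^ ℓ)) :
    Finset (Fin n) :=
  Finset.univ.filter fun i => ((T.enum.symm i).1 : ℕ) / 2 ^ (L - ℓ) = (τ : ℕ)

/-- A matrix has orthonormal columns. -/
def OrthonormalCols {m p : Type*} [Fintype m] [DecidableEq p] (U : Matrix m p ℝ) : Prop :=
  U.transpose * U = 1

/-! ### HSS matrices -/

/-- The submatrix of `A` with rows in `I` and columns in `J`. -/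
def subBlock {n : ℕ} (A : Matrix (Fin n) (Fin n) ℝ) (I J : Finset (Fin n)) : Matrix I J ℝ :=
  A.submatrix (fun i => (i : Fin n)) (fun j => (j : Fin n))

/-- The block diagonal matrix `[X 0; 0 Y]` where the rows of `X` and `Y` are indexed by the two
parts `I₁`, `I₂` of the index set `I`. -/
def stackDiag {n r : ℕ} (I I₁ I₂ : Finset (Fin n)) (X : Matrix I₁ (Fin r) ℝ)
    (Y : Matrix I₂ (Fin r) ℝ) : Matrix I (Fin r ⊕ Fin r) ℝ :=
  Matrix.of fun i j => match j with
    | .inl j => if h : (i : Fin n) ∈ I₁ then X ⟨i, h⟩ j else 0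
    | .inr j => if h : (i : Fin n) ∈ I₂ then Y ⟨i, h⟩ j else 0

/-- `A` is an HSS matrix of HSS rank `r` for the cluster tree `T`; `Ub`, `Vb` are the families
`U^(big)`, `V^(big)`, of which only the nodes of depth at most `L` matter. -/
def ClusterTree.IsHSS {n L : ℕ} (T : ClusterTree n L) (r : ℕ) (A : Matrix (Fin n) (Fin n) ℝ) :
    Prop :=
  ∃ Ub Vb : ∀ (ℓ : ℕ) (τ : Fin (2 ^ ℓ)), Matrix (T.cluster ℓ τ) (Fin r) ℝ,
    (∀ ℓ, 1 ≤ ℓ → ℓ ≤ L → ∀ τ, OrthonormalCols (Ub ℓ τ) ∧ OrthonormalCols (Vb ℓ τ)) ∧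
    (∀ ℓ, ℓ < L → ∀ (τ : Fin (2 ^ ℓ)) (b c : Fin 2), b ≠ c →
      ∃ At : Matrix (Fin r) (Fin r) ℝ,
        subBlock A (T.cluster (ℓ + 1) (child τ b)) (T.cluster (ℓ + 1) (child τ c)) =
          Ub (ℓ + 1) (child τ b) * At * (Vb (ℓ + 1) (child τ c)).transpose) ∧
    (∀ ℓ, ℓ < L → ∀ τ : Fin (2 ^ ℓ), ∃ U V : Matrix (Fin r ⊕ Fin r) (Fin r) ℝ,
      OrthonormalCols U ∧ OrthonormalCols V ∧
      Ub ℓ τ = stackDiag (T.cluster ℓ τ) (T.cluster (ℓ + 1) (child τ 0))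
        (T.cluster (ℓ + 1) (child τ 1))
        (Ub (ℓ + 1) (child τ 0)) (Ub (ℓ + 1) (child τ 1)) * U ∧
      Vb ℓ τ = stackDiag (T.cluster ℓ τ) (T.cluster (ℓ + 1) (child τ 0))
        (T.cluster (ℓ + 1) (child τ 1))
        (Vb (ℓ + 1) (child τ 0)) (Vb (ℓ + 1) (child τ 1)) * V)

/-! ### Symmetric telescopic decompositions -/

/-- Block sizes after merging the blocks of any two siblings. -/
def parentSize {ℓ : ℕ} (m : Fin (2 ^ (ℓ + 1)) → ℕ) : Fin (2 ^ ℓ) → ℕ :=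
  fun τ => m (child τ 0) + m (child τ 1)

/-- The identification of the indices of the merged blocks with those of the original blocks:
block `τ` is the concatenation of the blocks of the two children of `τ`. -/
def split {ℓ : ℕ} (m : Fin (2 ^ (ℓ + 1)) → ℕ) (x : BlockIdx (parentSize m)) : BlockIdx m :=
  Fin.addCases (motive := fun _ => BlockIdx m) (fun i => ⟨child x.1 0, i⟩)
    (fun i => ⟨child x.1 1, i⟩) x.2

/-- The generators of a symmetric telescopic decomposition on a tree of depth `L` whose leaves have
sizes `s`. On a tree of depth `0` there is only the matrix `D` of the root. On a tree of depth
`L + 1` there are the matrices `D τ` (of size `s τ × s τ`) and `U τ` (of size `s τ × m τ`) of the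
leaves, and the generators on the tree of depth `L` whose leaves have the sizes
`m α + m β`, with `α`, `β` the children. For telescopic rank `r` all `m τ` are `r`, and the trees
that occur above the leaves are the balanced trees with leaves of size `2 r`. -/
inductive TelDecomp : (L : ℕ) → (Fin (2 ^ L) → ℕ) → Type
  | root (s : Fin (2 ^ 0) → ℕ) (D : ∀ τ, Matrix (Fin (s τ)) (Fin (s τ)) ℝ) : TelDecomp 0 s
  | level {L : ℕ} (s m : Fin (2 ^ (L + 1)) → ℕ)
      (D : ∀ τ, Matrix (Fin (s τ)) (Fin (s τ)) ℝ)
      (U : ∀ τ, Matrix (Fin (s τ)) (Fin (m τ)) ℝ)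
      (up : TelDecomp L (parentSize m)) : TelDecomp (L + 1) s

/-- The block diagonal matrix of the `U τ`, its columns regarded as indexed by the merged blocks. -/
def blkdiagU {L : ℕ} {s m : Fin (2 ^ (L + 1)) → ℕ} (U : ∀ τ, Matrix (Fin (s τ)) (Fin (m τ)) ℝ) :
    Matrix (BlockIdx s) (BlockIdx (parentSize m)) ℝ :=
  (Matrix.blockDiagonal' U).submatrix id (split m)

/-- The matrix generated by a symmetric telescopic decomposition. -/
def TelDecomp.toMatrix {L : ℕ} {s : Fin (2 ^ L) → ℕ} :
    TelDecomp L s → Matrix (BlockIdx s) (BlockIdx s) ℝ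
  | .root _ D => Matrix.blockDiagonal' D
  | .level _ _ D U up =>
      Matrix.blockDiagonal' D + blkdiagU U * up.toMatrix * (blkdiagU U).transpose

/-- All `U τ` have orthonormal columns and all `D τ` are symmetric. -/
def TelDecomp.IsSymmetric {L : ℕ} {s : Fin (2 ^ L) → ℕ} : TelDecomp L s → Prop
  | .root _ D => ∀ τ, (D τ).IsSymm
  | .level _ _ D U up =>
      (∀ τ, (D τ).IsSymm) ∧ (∀ τ, OrthonormalCols (U τ)) ∧ up.IsSymmetric

/-- A decomposition is standard if on every level `D τ` is the diagonal block at `τ` of the matrix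
that is generated by the part of the decomposition up to that level (on level `0` this always
holds). -/
def TelDecomp.IsStandard {L : ℕ} {s : Fin (2 ^ L) → ℕ} : TelDecomp L s → Prop
  | .root _ _ => True
  | .level s m D U up =>
      (∀ τ, (TelDecomp.level s m D U up).toMatrix.blockDiag' τ = D τ) ∧ up.IsStandard

/-- The `n × n` matrix generated by a decomposition on the cluster tree `T`. -/
def ClusterTree.matrixOf {n L : ℕ} (T : ClusterTree n L) (t : TelDecomp L T.leafSize) :
    Matrix (Fin n) (Fin n) ℝ :=
  Matrix.reindex T.enum T.enum t.toMatrix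

/-! ### Rational Krylov subspaces -/

/-- The polynomial `∏ (x - ξ)` over the finite poles `ξ` of the list. -/
def poleDenom {k : ℕ} (ξ : Fin k → OnePoint ℂ) : ℂ[X] :=
  ∏ j, (ξ j).elim 1 (fun z => X - C z)

/-- The list of poles is closed under complex conjugation, with multiplicities (`∞` is its own
conjugate). -/
def ConjClosed {k : ℕ} (ξ : Fin k → OnePoint ℂ) : Prop :=
  ∃ σ : Equiv.Perm (Fin k), ∀ j, ξ (σ j) = (ξ j).map (starRingEnd ℂ)

/-- A real matrix regarded as a complex one. -/
def toC {m p : Type*} (M : Matrix m p ℝ) : Matrix m p ℂ :=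
  M.map (fun x => (x : ℂ))

/-- No pole is an eigenvalue of `M`. -/
def PolesAdmissible {n k : ℕ} (M : Matrix (Fin n) (Fin n) ℝ) (ξ : Fin k → OnePoint ℂ) : Prop :=
  ∀ z ∈ spectrum ℂ (toC M), ∀ j, ξ j ≠ (z : OnePoint ℂ)

/-- The block rational Krylov subspace `Q(M, B, ξ)`. -/
def ratKrylov {n b k : ℕ} (M : Matrix (Fin n) (Fin n) ℝ) (B : Matrix (Fin n) (Fin b) ℝ)
    (ξ : Fin k → OnePoint ℂ) : Set (Matrix (Fin n) (Fin b) ℝ) :=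
  {Y | ∃ K : Fin k → Matrix (Fin b) (Fin b) ℝ,
    toC Y = (aeval (toC M) (poleDenom ξ))⁻¹ * toC (∑ j : Fin k, M ^ (j : ℕ) * B * K j)}

/-- The columns of `W` are orthonormal and span the same space as the columns of the block vectors
in `Q`. -/
def IsOrthonormalBasisOf {n b p : ℕ} (W : Matrix (Fin n) (Fin p) ℝ)
    (Q : Set (Matrix (Fin n) (Fin b) ℝ)) : Prop :=
  OrthonormalCols W ∧
    Submodule.span ℝ (Set.range W.col) = Submodule.span ℝ {v | ∃ Y ∈ Q, ∃ j, v = Y.col j}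

/-! ### The algorithm -/

/-- The block diagonal matrix `[X 0; 0 Y]`. -/
def diag2 {a b c d : ℕ} (X : Matrix (Fin a) (Fin b) ℝ) (Y : Matrix (Fin c) (Fin d) ℝ) :
    Matrix (Fin (a + c)) (Fin (b + d)) ℝ :=
  Matrix.reindex finSumFinEquiv finSumFinEquiv (Matrix.fromBlocks X 0 0 Y)

/-- Replace `D τ` by `F τ + E τ * D τ * (E τ)ᵀ` and `U τ` by `E τ * U τ` at the leaves. -/
def TelDecomp.updateLeaves {L : ℕ} {s s' : Fin (2 ^ L) → ℕ} :
    TelDecomp L s → (∀ τ, Matrix (Fin (s' τ)) (Fin (s τ)) ℝ) →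
      (∀ τ, Matrix (Fin (s' τ)) (Fin (s' τ)) ℝ) → TelDecomp L s'
  | .root _ D, E, F => .root s' fun τ => F τ + E τ * D τ * (E τ).transpose
  | .level _ m D U up, E, F =>
      .level s' m (fun τ => F τ + E τ * D τ * (E τ).transpose) (fun τ => E τ * U τ) up

/-- `AlgorithmRun f ξ t out`: starting from the generators `{U τ, D τ} = t`, the algorithm with the
function `f` and the poles `ξ` can return the generators `{W τ, C τ} = out`. (It is a relation
because the algorithm is free to choose the orthonormal bases `W τ`.) The levels are processed from
the leaves to the root. In `level`, the matrices `Dt τ` and `Z τ` are the current matrices `D̃ τ` and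
`Z τ` at the nodes of the current level, and `up` holds the input generators of the levels above;
at the start `Z τ = U τ` and `D̃ τ = D τ` for the leaves. -/
inductive AlgorithmRun (f : ℝ → ℝ) {k : ℕ} (ξ : Fin k → OnePoint ℂ) :
    {L : ℕ} → {s : Fin (2 ^ L) → ℕ} → TelDecomp L s → TelDecomp L s → Prop
  | root (s : Fin (2 ^ 0) → ℕ) (Dt : ∀ τ, Matrix (Fin (s τ)) (Fin (s τ)) ℝ) :
      AlgorithmRun f ξ (.root s Dt) (.root s fun τ => cfc f (Dt τ))
  | level {L : ℕ} (s m p : Fin (2 ^ (L + 1)) → ℕ)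
      (Dt : ∀ τ, Matrix (Fin (s τ)) (Fin (s τ)) ℝ)
      (Z : ∀ τ, Matrix (Fin (s τ)) (Fin (m τ)) ℝ)
      (up : TelDecomp L (parentSize m))
      (W : ∀ τ, Matrix (Fin (s τ)) (Fin (p τ)) ℝ)
      (out : TelDecomp L (parentSize p))
      (poles : ∀ τ, PolesAdmissible (Dt τ) ξ)
      (basis : ∀ τ, IsOrthonormalBasisOf (W τ) (ratKrylov (Dt τ) (Z τ) ξ))
      (next : AlgorithmRun f ξ
        (up.updateLeaves (s' := parentSize p)
          (fun τ => diag2 ((W (child τ 0)).transpose * Z (child τ 0))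
            ((W (child τ 1)).transpose * Z (child τ 1)))
          (fun τ => diag2 ((W (child τ 0)).transpose * Dt (child τ 0) * W (child τ 0))
            ((W (child τ 1)).transpose * Dt (child τ 1) * W (child τ 1))))
        out) :
      AlgorithmRun f ξ (.level s m Dt Z up)
        (.level s p
          (fun τ => cfc f (Dt τ) -
            W τ * cfc f ((W τ).transpose * Dt τ * W τ) * (W τ).transpose)
          W out)

/-! ### Norms and rational approximation -/

/-- The spectral norm of a matrix. -/
def norm2 {n : ℕ} (M : Matrix (Fin n) (Fin n) ℝ) : ENNReal :=
  ‖Matrix.toEuclideanCLM (n := Fin n) (𝕜 := ℝ) M‖ₑ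

/-- The set `P_k / q_k` of rational functions `p / q_k` with `p` of degree at most `k - 1`. -/
def ratSpace {k : ℕ} (ξ : Fin k → OnePoint ℂ) : Set (RatFunc ℂ) :=
  {r | ∃ p : ℂ[X], p.degree < (k : WithBot ℕ) ∧
    r = algebraMap ℂ[X] (RatFunc ℂ) p / algebraMap ℂ[X] (RatFunc ℂ) (poleDenom ξ)}

/-- The value of a rational function at a real point (common factors of numerator and denominator
are cancelled first). -/
def evalAt (r : RatFunc ℂ) (x : ℝ) : ℂ :=
  r.eval (RingHom.id ℂ) (x : ℂ)

/-- The supremum norm of `f - r` on `[a, b]`; it is `∞` if `r` has a pole there and `a < b`. -/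
def supDist (f : ℝ → ℝ) (r : RatFunc ℂ) (a b : ℝ) : ENNReal :=
  ⨆ x ∈ Set.Icc a b, ‖(f x : ℂ) - evalAt r x‖ₑ

end HSSFun

end

/-! ### Noncommutative Bezoutians. -/

namespace HSSFun

/-! On one level write `A = D + U B Uᵀ`, where `D` and `U` are block diagonal, and let `W` be the
block diagonal matrix of the Krylov bases. For `r = P / q` the difference `r(A) - r(D)` equals
`q(D)⁻¹ (q(D) P(A) - P(D) q(A)) q(A)⁻¹`. The middle factor is a noncommutative Bezoutian, a
combination of terms `D ^ i (D - A) A ^ j` (`bezoutian_mem`). Since `D - A = -U B Uᵀ`, every term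
pairs a rational Krylov block of `D` with the transpose of one of `A`. Both blocks lie in the range
of `W` (`krylov_update`), and the Galerkin projection is exact on them (`krylov_exact`). Hence `r(A)
- r(D) = W (r(Wᵀ A W) - r(Wᵀ D W)) Wᵀ` (`rational_update_exact`).

Replacing `r` by `f` in the four terms costs at most `ε` each (`norm_update_error_le`), because all
four spectra lie in `[a, b]`: by standardness the blocks of `D` are principal submatrices of `A`,
and compressions do not leave the interval. What remains is `f(Wᵀ A W)`, and `Wᵀ A W` is generated
by the updated decomposition one level up (`toMatrix_next`), which is again standard. Each of the
`L` levels thus contributes `4 ε`, and the root contributes nothing.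

Poles may lie in `[a, b]`. The denominator is therefore factored as `g q`, with all zeros in `[a,
b]` moved to `g`. The Krylov space of the full denominator contains the one for `q` with `κ = k -
deg g` powers (`mem_ratKrylov`). On a nondegenerate interval a function with a pole there has
infinite distance from `f`, so the minimum is a best approximation from the finite-dimensional space
of `p / q` with `deg p < κ`. -/

theorem pow_mul_pow_sub_mem {R : Type*} [Ring R] [Algebra ℝ R] (x y : R) (N : Submodule ℝ R)
    (κ : ℕ) (hN : ∀ i < κ, ∀ j < κ, x ^ i * (x - y) * y ^ j ∈ N) (a d e : ℕ)
    (h : a + d + e ≤ κ) :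
    x ^ a * y ^ (a + d + e) - x ^ (a + d) * y ^ (a + e) ∈ N := by
  induction d generalizing e with
  | zero => simp
  | succ d ih =>
    -- One unit of exponent is moved from `y` to `x` at a time; each move costs one generator `x ^ i
    -- * (x - y) * y ^ j`.
    have h1 := ih (e + 1) (by omega)
    have h2 := hN (a + d) (by omega) (a + e) (by omega)
    have : x ^ a * y ^ (a + (d + 1) + e) - x ^ (a + (d + 1)) * y ^ (a + e) =
        (x ^ a * y ^ (a + d + (e + 1)) - x ^ (a + d) * y ^ (a + (e + 1))) -
          x ^ (a + d) * (x - y) * y ^ (a + e) := by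
      rw [show a + (d + 1) + e = a + d + (e + 1) by ring, ← add_assoc a d 1, ← add_assoc a e 1,
        pow_succ x (a + d), pow_succ' y (a + e)]
      noncomm_ring
    rw [this]
    exact N.sub_mem h1 h2

/-- A noncommutative Bezoutian: `q(x) p(y) - p(x) q(y)` lies in the span of the
`x ^ i * (x - y) * y ^ j`. -/
theorem bezoutian_mem {R : Type*} [Ring R] [Algebra ℝ R] (x y : R) (N : Submodule ℝ R)
    (κ : ℕ) (hN : ∀ i < κ, ∀ j < κ, x ^ i * (x - y) * y ^ j ∈ N) (p q : ℝ[X])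
    (hp : p.natDegree ≤ κ) (hq : q.natDegree ≤ κ) :
    aeval x q * aeval y p - aeval x p * aeval y q ∈ N := by
  have hle : ∀ a b : ℕ, a ≤ b → b ≤ κ → x ^ a * y ^ b - x ^ b * y ^ a ∈ N := by
    intro a b hab hb
    obtain ⟨d, rfl⟩ := Nat.exists_eq_add_of_le hab
    simpa using pow_mul_pow_sub_mem x y N κ hN a d 0 (by simpa using hb)
  have hmon : ∀ a b : ℕ, a ≤ κ → b ≤ κ → x ^ a * y ^ b - x ^ b * y ^ a ∈ N := by
    intro a b ha hb
    rcases le_total a b with h | h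
    · exact hle a b h hb
    · rw [← neg_sub]
      exact N.neg_mem (hle b a h ha)
  -- Renaming the summation indices in the second product gives both double sums the same
  -- coefficients, which leaves antisymmetric monomial differences.
  have e : aeval x q * aeval y p - aeval x p * aeval y q =
      ∑ a ∈ Finset.range (κ + 1), ∑ b ∈ Finset.range (κ + 1),
        (q.coeff a * p.coeff b) • (x ^ a * y ^ b - x ^ b * y ^ a) := by
    have hx : ∀ (z : R) (s : ℝ[X]), s.natDegree ≤ κ →
        aeval z s = ∑ i ∈ Finset.range (κ + 1), s.coeff i • z ^ i := fun z s hs =>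
      aeval_eq_sum_range' (Nat.lt_succ_of_le hs) z
    rw [hx x q hq, hx y p hp, hx x p hp, hx y q hq]
    simp only [smul_sub, Finset.sum_sub_distrib]
    congr 1
    · simp only [Finset.sum_mul_sum, smul_mul_smul_comm]
    · rw [Finset.sum_mul_sum, Finset.sum_comm]
      simp only [smul_mul_smul_comm, mul_comm]
  rw [e]
  refine N.sum_mem fun a ha => N.sum_mem fun b hb => N.smul_mem _ (hmon a b ?_ ?_)
  · exact Nat.lt_succ_iff.mp (Finset.mem_range.mp ha)
  · exact Nat.lt_succ_iff.mp (Finset.mem_range.mp hb)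

/-! ### Exactness of the Krylov projection and of the low-rank update. -/

section Matrices

variable {n p u : Type*} [Fintype n] [DecidableEq n] [Fintype p]

open Matrix

theorem aeval_mul_inv {M : Matrix n n ℝ} {q : ℝ[X]} (h : IsUnit (aeval M q)) :
    aeval M q * (aeval M q)⁻¹ = 1 :=
  Matrix.mul_nonsing_inv _ ((Matrix.isUnit_iff_isUnit_det _).mp h)

theorem aeval_inv_mul {M : Matrix n n ℝ} {q : ℝ[X]} (h : IsUnit (aeval M q)) :
    (aeval M q)⁻¹ * aeval M q = 1 :=
  Matrix.nonsing_inv_mul _ ((Matrix.isUnit_iff_isUnit_det _).mp h)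

theorem aeval_inv_mul_comm {M : Matrix n n ℝ} {q : ℝ[X]} (h : IsUnit (aeval M q)) (s : ℝ[X]) :
    (aeval M q)⁻¹ * aeval M s = aeval M s * (aeval M q)⁻¹ := by
  have hc : aeval M q * aeval M s = aeval M s * aeval M q := by
    rw [← map_mul, ← map_mul, mul_comm]
  calc (aeval M q)⁻¹ * aeval M s
      = (aeval M q)⁻¹ * (aeval M s * aeval M q) * (aeval M q)⁻¹ := by
        rw [← mul_assoc, mul_assoc _ (aeval M q), aeval_mul_inv h, mul_one]
    _ = _ := by rw [← hc, ← mul_assoc, aeval_inv_mul h, one_mul]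

theorem aeval_inv_mul_pow_comm {M : Matrix n n ℝ} {q : ℝ[X]} (h : IsUnit (aeval M q)) (i : ℕ) :
    (aeval M q)⁻¹ * M ^ i = M ^ i * (aeval M q)⁻¹ := by
  simpa using aeval_inv_mul_comm h (X ^ i)

/-- Exactness of the Galerkin projection on a space that contains the rational Krylov space. -/
theorem krylov_exact [DecidableEq p] {M : Matrix n n ℝ} {W : Matrix n p ℝ} {U : Matrix n u ℝ}
    {q : ℝ[X]} {κ : ℕ}
    (hq : q.natDegree ≤ κ) (hM : IsUnit (aeval M q)) (hH : IsUnit (aeval (Wᵀ * M * W) q))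
    (hK : ∀ i < κ, W * Wᵀ * ((aeval M q)⁻¹ * M ^ i * U) = (aeval M q)⁻¹ * M ^ i * U) {i : ℕ}
    (hi : i < κ) :
    W * ((aeval (Wᵀ * M * W) q)⁻¹ * (Wᵀ * M * W) ^ i * (Wᵀ * U)) = (aeval M q)⁻¹ * M ^ i * U := by
  set H := Wᵀ * M * W with hHdef
  -- Powers up to `κ`, one more than the projection fixes, are reached because the last
  -- multiplication by `M` happens before `Wᵀ` is applied. They are needed since `q` may have degree
  -- `κ`. The factor `M ^ 0` gives the start block the same shape as the others.
  have hpow : ∀ j ≤ κ, H ^ j * (Wᵀ * ((aeval M q)⁻¹ * M ^ 0 * U)) =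
      Wᵀ * ((aeval M q)⁻¹ * M ^ j * U) := by
    intro j
    induction j with
    | zero => simp
    | succ j ih =>
      intro hj
      rw [pow_succ' H, Matrix.mul_assoc, ih (by omega), hHdef]
      calc Wᵀ * M * W * (Wᵀ * ((aeval M q)⁻¹ * M ^ j * U))
          = Wᵀ * (M * (W * Wᵀ * ((aeval M q)⁻¹ * M ^ j * U))) := by
            simp only [Matrix.mul_assoc]
        _ = Wᵀ * ((aeval M q)⁻¹ * M ^ (j + 1) * U) := by
            rw [hK j (by omega), aeval_inv_mul_pow_comm hM, aeval_inv_mul_pow_comm hM, pow_succ']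
            simp only [Matrix.mul_assoc]
  have h0 : aeval H q * (Wᵀ * ((aeval M q)⁻¹ * M ^ 0 * U)) = Wᵀ * U := by
    have e : aeval H q * (Wᵀ * ((aeval M q)⁻¹ * M ^ 0 * U)) =
        Wᵀ * ((aeval M q)⁻¹ * aeval M q * U) := by
      rw [aeval_eq_sum_range' (Nat.lt_succ_of_le hq) H, Matrix.sum_mul]
      have hr : (aeval M q)⁻¹ * aeval M q = ∑ j ∈ Finset.range κ.succ,
          q.coeff j • ((aeval M q)⁻¹ * M ^ j) := by
        conv_lhs => rw [aeval_eq_sum_range' (Nat.lt_succ_of_le hq) M, Matrix.mul_sum]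
        simp only [Matrix.mul_smul, aeval_eq_sum_range' (Nat.lt_succ_of_le hq) M]
      rw [hr, Matrix.sum_mul, Matrix.mul_sum]
      refine Finset.sum_congr rfl fun j hj => ?_
      rw [Matrix.smul_mul, Matrix.smul_mul, Matrix.mul_smul,
        hpow j (Nat.lt_succ_iff.mp (Finset.mem_range.mp hj))]
    rw [e, aeval_inv_mul hM, Matrix.one_mul]
  have h1 : (aeval H q)⁻¹ * H ^ i * (Wᵀ * U) = Wᵀ * ((aeval M q)⁻¹ * M ^ i * U) := by
    rw [← hpow i hi.le, ← h0, aeval_inv_mul_pow_comm hH, Matrix.mul_assoc,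
      ← Matrix.mul_assoc (aeval H q)⁻¹, aeval_inv_mul hH, Matrix.one_mul]
  rw [h1, ← Matrix.mul_assoc, hK i hi]

theorem transpose_aeval (M : Matrix n n ℝ) (q : ℝ[X]) : (aeval M q)ᵀ = aeval Mᵀ q := by
  induction q using Polynomial.induction_on' with
  | add p q hp hq => simp [hp, hq]
  | monomial i c => simp [aeval_monomial, Algebra.algebraMap_eq_smul_one, Matrix.transpose_pow]

/-- As `D` and `A` need not commute, the common denominator is two-sided: `q(D)` on the left and
`q(A)` on the right. -/
theorem sub_eq_inv_bezoutian {D A : Matrix n n ℝ} {P q : ℝ[X]} (hD : IsUnit (aeval D q))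
    (hA : IsUnit (aeval A q)) :
    (aeval A q)⁻¹ * aeval A P - (aeval D q)⁻¹ * aeval D P =
      (aeval D q)⁻¹ * (aeval D q * aeval A P - aeval D P * aeval A q) * (aeval A q)⁻¹ := by
  rw [Matrix.mul_sub, Matrix.sub_mul, aeval_inv_mul_comm hA, ← Matrix.mul_assoc,
    aeval_inv_mul hD, Matrix.one_mul, Matrix.mul_assoc, Matrix.mul_assoc,
    aeval_mul_inv hA, Matrix.mul_one]

/-- A space that contains the rational Krylov space of `D` also contains that of a low-rank
modification of `D`. -/
theorem krylov_update [Fintype u] {D A : Matrix n n ℝ} {W : Matrix n p ℝ} {U : Matrix n u ℝ}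
    {B : Matrix u u ℝ} {q : ℝ[X]} {κ : ℕ} (hAD : A = D + U * B * Uᵀ)
    (hq : q.natDegree ≤ κ) (hD : IsUnit (aeval D q)) (hA : IsUnit (aeval A q))
    (hK : ∀ i < κ, W * Wᵀ * ((aeval D q)⁻¹ * D ^ i * U) = (aeval D q)⁻¹ * D ^ i * U)
    {j : ℕ} (hj : j < κ) :
    W * Wᵀ * ((aeval A q)⁻¹ * A ^ j * U) = (aeval A q)⁻¹ * A ^ j * U := by
  -- The kernel consists of the `Z` for which `W * Wᵀ` fixes `q(D)⁻¹ Z`.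
  let φ : Matrix n n ℝ →ₗ[ℝ] Matrix n n ℝ :=
    LinearMap.mulLeft ℝ (W * Wᵀ * (aeval D q)⁻¹) - LinearMap.mulLeft ℝ (aeval D q)⁻¹
  have hmem := bezoutian_mem D A (LinearMap.ker φ) κ (by
    intro i hi j _
    have hsub : D - A = -(U * B * Uᵀ) := by rw [hAD]; abel
    have := congrArg (fun Z => Z * (B * Uᵀ * A ^ j)) (hK i hi)
    simp only [Matrix.mul_assoc] at this
    simp only [φ, LinearMap.mem_ker, LinearMap.sub_apply, LinearMap.mulLeft_apply, hsub,
      Matrix.mul_neg, Matrix.neg_mul, Matrix.mul_assoc, this, sub_self]) (X ^ j) q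
      (by simpa using hj.le) hq
  simp only [φ, LinearMap.mem_ker, LinearMap.sub_apply, LinearMap.mulLeft_apply, sub_eq_zero]
    at hmem
  have hb := sub_eq_inv_bezoutian (P := X ^ j) hD hA
  have h1 : W * Wᵀ * ((aeval A q)⁻¹ * A ^ j - (aeval D q)⁻¹ * D ^ j) =
      (aeval A q)⁻¹ * A ^ j - (aeval D q)⁻¹ * D ^ j := by
    simp only [map_pow, aeval_X] at hmem hb
    rw [hb, ← Matrix.mul_assoc, ← Matrix.mul_assoc (W * Wᵀ), hmem]
  have h2 := congrArg (fun Z => Z * U) h1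
  simp only [Matrix.mul_sub, Matrix.sub_mul] at h2
  rw [Matrix.mul_assoc (W * Wᵀ) _ U, Matrix.mul_assoc (W * Wᵀ) _ U, hK j hj] at h2
  exact sub_left_injective h2

/-- Exactness of the update formula for rational functions. -/
theorem rational_update_exact [DecidableEq p] [Fintype u] {D A : Matrix n n ℝ}
    {W : Matrix n p ℝ} {U : Matrix n u ℝ} {B : Matrix u u ℝ} {P q : ℝ[X]} {κ : ℕ}
    (hAD : A = D + U * B * Uᵀ) (hAs : Aᵀ = A)
    (hP : P.natDegree ≤ κ) (hq : q.natDegree ≤ κ) (hD : IsUnit (aeval D q))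
    (hA : IsUnit (aeval A q)) (hH : IsUnit (aeval (Wᵀ * D * W) q))
    (hG : IsUnit (aeval (Wᵀ * A * W) q))
    (hK : ∀ i < κ, W * Wᵀ * ((aeval D q)⁻¹ * D ^ i * U) = (aeval D q)⁻¹ * D ^ i * U) :
    (aeval A q)⁻¹ * aeval A P - (aeval D q)⁻¹ * aeval D P =
      W * ((aeval (Wᵀ * A * W) q)⁻¹ * aeval (Wᵀ * A * W) P -
        (aeval (Wᵀ * D * W) q)⁻¹ * aeval (Wᵀ * D * W) P) * Wᵀ := by
  set H := Wᵀ * D * W with hHdef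
  set G := Wᵀ * A * W with hGdef
  have hGs : Gᵀ = G := by
    simp only [hGdef, Matrix.transpose_mul, Matrix.transpose_transpose, hAs, Matrix.mul_assoc]
  have hGH : H - G = -(Wᵀ * U * B * (Wᵀ * U)ᵀ) := by
    rw [hGdef, hAD, hHdef]
    simp only [Matrix.mul_add, Matrix.add_mul, Matrix.transpose_mul, Matrix.transpose_transpose,
      Matrix.mul_assoc]
    abel
  have hsub : D - A = -(U * B * Uᵀ) := by rw [hAD]; abel
  rw [sub_eq_inv_bezoutian hD hA, sub_eq_inv_bezoutian hH hG]
  -- The kernel consists of the pairs `(X, Y)` with `q(D)⁻¹ X q(A)⁻¹ = W q(H)⁻¹ Y q(G)⁻¹ Wᵀ`.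
  -- Working in the product ring expands the large and the small Bezoutian with the same
  -- coefficients, so only matching generators have to be compared.
  let φ : Matrix n n ℝ × Matrix p p ℝ →ₗ[ℝ] Matrix n n ℝ :=
    (LinearMap.mulRight ℝ (aeval A q)⁻¹ ∘ₗ LinearMap.mulLeft ℝ (aeval D q)⁻¹) ∘ₗ
      LinearMap.fst ℝ _ _ -
    ((mulLeftLinearMap n ℝ W ∘ₗ mulRightLinearMap p ℝ Wᵀ) ∘ₗ
      (LinearMap.mulRight ℝ (aeval G q)⁻¹ ∘ₗ LinearMap.mulLeft ℝ (aeval H q)⁻¹)) ∘ₗ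
      LinearMap.snd ℝ _ _
  have hmem := bezoutian_mem ((D, H) : Matrix n n ℝ × Matrix p p ℝ) (A, G) (LinearMap.ker φ) κ
    (by
      intro i hi j hj
      have e1 := krylov_exact hq hD hH hK hi
      -- The right factor is a transposed Krylov block of `A`; symmetry of `A` and `G` brings it to
      -- the form required.
      have e2 := congrArg Matrix.transpose
        (krylov_exact hq hA hG (fun i hi => krylov_update hAD hq hD hA hK hi) hj)
      simp only [Matrix.transpose_mul, Matrix.transpose_nonsing_inv, transpose_aeval,
        Matrix.transpose_pow, hAs, Matrix.transpose_transpose] at e2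
      rw [← Matrix.mul_assoc Wᵀ A W, ← hGdef] at e2
      rw [← hHdef] at e1
      simp only [φ, LinearMap.mem_ker, LinearMap.sub_apply, LinearMap.comp_apply,
        LinearMap.mulLeft_apply, LinearMap.mulRight_apply, LinearMap.fst_apply,
        LinearMap.snd_apply, Prod.pow_mk, Prod.mk_sub_mk, Prod.mk_mul_mk, hsub, hGH,
        mulLeftLinearMap_apply, mulRightLinearMap_apply, Matrix.mul_neg,
        Matrix.neg_mul]
      rw [sub_eq_zero, neg_inj]
      calc (aeval D q)⁻¹ * (D ^ i * (U * B * Uᵀ) * A ^ j) * (aeval A q)⁻¹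
          = ((aeval D q)⁻¹ * D ^ i * U) * B * (Uᵀ * (A ^ j * (aeval A q)⁻¹)) := by
            simp only [Matrix.mul_assoc]
        _ = _ := by
            rw [← e1, ← e2]
            simp only [Matrix.mul_assoc, Matrix.transpose_mul, Matrix.transpose_transpose])
    P q hP hq
  have hpr : ∀ (x : Matrix n n ℝ) (y : Matrix p p ℝ) (s : ℝ[X]),
      aeval ((x, y) : Matrix n n ℝ × Matrix p p ℝ) s = (aeval x s, aeval y s) := by
    intro x y s
    exact aeval_prod_apply (x, y) s
  rw [hpr, hpr, hpr, hpr] at hmem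
  simpa only [φ, LinearMap.mem_ker, LinearMap.sub_apply, LinearMap.comp_apply,
        LinearMap.mulLeft_apply, LinearMap.mulRight_apply, LinearMap.fst_apply,
        LinearMap.snd_apply, Prod.mk_sub_mk, Prod.mk_mul_mk,
        mulLeftLinearMap_apply, mulRightLinearMap_apply, sub_eq_zero,
        Matrix.mul_assoc] using hmem

end Matrices

/-! ### Functional calculus, compressions and the one-step error. -/

section FunctionalCalculus

open Matrix

theorem isSelfAdjoint_of_isSymm {n : Type*} {M : Matrix n n ℝ} (hM : M.IsSymm) : IsSelfAdjoint M := by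
  rw [IsSelfAdjoint, star_eq_conjTranspose, conjTranspose_eq_transpose_of_trivial]
  exact hM

theorem isSymm_compression {n p : Type*} [Fintype n] {M : Matrix n n ℝ} (hM : M.IsSymm)
    (W : Matrix n p ℝ) : (Wᵀ * M * W).IsSymm := by
  rw [Matrix.IsSymm, Matrix.transpose_mul, Matrix.transpose_mul, hM.eq, Matrix.transpose_transpose,
    Matrix.mul_assoc]

open scoped Matrix.Norms.L2Operator in
theorem norm_le_one_of_orthonormalCols {n p : Type*} [Fintype n]
    [Fintype p] [DecidableEq p] {W : Matrix n p ℝ} (hW : OrthonormalCols W) : ‖W‖ ≤ 1 := by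
  have h := Matrix.l2_opNorm_conjTranspose_mul_self W
  rw [conjTranspose_eq_transpose_of_trivial, hW] at h
  -- Only an inequality, because `p` may be empty.
  have h1 : ‖(1 : Matrix p p ℝ)‖ ≤ 1 := by
    rw [← Matrix.diagonal_one, Matrix.l2_opNorm_diagonal]
    exact (pi_norm_le_iff_of_nonneg zero_le_one).mpr fun i => by simp
  nlinarith [norm_nonneg W]

theorem one_submatrix_id_mul {n p r : Type*} [Fintype n] [DecidableEq n] (e : p → n)
    (M : Matrix n r ℝ) :
    (1 : Matrix n n ℝ).submatrix e id * M = M.submatrix e id := by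
  ext i j
  simp [Matrix.mul_apply, Matrix.one_apply]

theorem mul_one_submatrix_id {n p r : Type*} [Fintype n] [DecidableEq n] (e : p → n)
    (M : Matrix r n ℝ) :
    M * (1 : Matrix n n ℝ).submatrix id e = M.submatrix id e := by
  ext i j
  simp [Matrix.mul_apply, Matrix.one_apply]

/-- Exhibits a principal submatrix as a compression, so that bounds for compressions apply to
diagonal blocks and to reindexings. -/
theorem orthonormalCols_one_submatrix {n p : Type*} [Fintype n] [DecidableEq n]
    [DecidableEq p] {e : p → n} (he : Function.Injective e) :
    OrthonormalCols ((1 : Matrix n n ℝ).submatrix id e) := by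
  rw [OrthonormalCols, Matrix.transpose_submatrix, Matrix.transpose_one, one_submatrix_id_mul,
    Matrix.submatrix_submatrix]
  exact Matrix.submatrix_one e he

variable {n p : Type*} [Fintype n] [DecidableEq n] [Fintype p] [DecidableEq p]

theorem finite_spectrum_real {M : Matrix n n ℝ} (hM : M.IsSymm) : (spectrum ℝ M).Finite := by
  have h : M.IsHermitian := isSelfAdjoint_of_isSymm hM
  rw [h.spectrum_real_eq_range_eigenvalues]
  exact Set.finite_range _

theorem continuousOn_spectrum {M : Matrix n n ℝ} (hM : M.IsSymm) (f : ℝ → ℝ) :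
    ContinuousOn f (spectrum ℝ M) :=
  (finite_spectrum_real hM).continuousOn f

theorem cfc_eq_aeval {M : Matrix n n ℝ} (hM : M.IsSymm) {f : ℝ → ℝ} {s : ℝ[X]}
    (h : ∀ x ∈ spectrum ℝ M, f x = s.eval x) : cfc f M = aeval M s := by
  rw [cfc_congr (g := s.eval) h, cfc_polynomial s M (isSelfAdjoint_of_isSymm hM)]

theorem isUnit_aeval_of_eval_ne_zero {M : Matrix n n ℝ} (hM : M.IsSymm) {q : ℝ[X]}
    (h : ∀ x ∈ spectrum ℝ M, q.eval x ≠ 0) : IsUnit (aeval M q) := by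
  rw [← cfc_polynomial q M (isSelfAdjoint_of_isSymm hM)]
  exact (isUnit_cfc_iff _ M (continuousOn_spectrum hM _) (isSelfAdjoint_of_isSymm hM)).mpr h

theorem cfc_rational {M : Matrix n n ℝ} (hM : M.IsSymm) {P q : ℝ[X]}
    (h : ∀ x ∈ spectrum ℝ M, q.eval x ≠ 0) :
    cfc (fun x => P.eval x / q.eval x) M = (aeval M q)⁻¹ * aeval M P := by
  have hu := isUnit_aeval_of_eval_ne_zero hM h
  have hmul : aeval M q * cfc (fun x => P.eval x / q.eval x) M = aeval M P := by
    rw [← cfc_polynomial q M (isSelfAdjoint_of_isSymm hM),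
      ← cfc_polynomial P M (isSelfAdjoint_of_isSymm hM),
      ← cfc_mul _ _ M (continuousOn_spectrum hM _) (continuousOn_spectrum hM _)]
    exact cfc_congr fun x hx => mul_div_cancel₀ _ (h x hx)
  rw [← hmul, ← Matrix.mul_assoc, aeval_inv_mul hu, Matrix.one_mul]

/-- On finite spectra every function is a polynomial, and polynomials pass through algebra
homomorphisms such as reindexing and block diagonal embedding. -/
theorem exists_polynomial_eq_on {S : Set ℝ} (hS : S.Finite) (f : ℝ → ℝ) :
    ∃ s : ℝ[X], ∀ x ∈ S, f x = s.eval x := by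
  refine ⟨Lagrange.interpolate hS.toFinset id f, fun x hx => ?_⟩
  exact (Lagrange.eval_interpolate_at_node f (Set.injOn_id _) (hS.mem_toFinset.mpr hx)).symm

/-- The functional calculus commutes with reindexing. -/
theorem cfc_submatrix_equiv {M : Matrix n n ℝ} (hM : M.IsSymm) (f : ℝ → ℝ) (e : p ≃ n) :
    cfc f (M.submatrix e e) = (cfc f M).submatrix e e := by
  have hs : (M.submatrix e e).IsSymm := hM.submatrix e
  obtain ⟨s, h⟩ := exists_polynomial_eq_on ((finite_spectrum_real hM).union
    (finite_spectrum_real hs)) f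
  rw [cfc_eq_aeval hM fun x hx => h x (.inl hx), cfc_eq_aeval hs fun x hx => h x (.inr hx)]
  exact (Polynomial.aeval_algHom_apply (Matrix.reindexAlgEquiv ℝ ℝ e.symm).toAlgHom M s)

theorem spectrum_submatrix_equiv (M : Matrix n n ℝ) (e : p ≃ n) :
    spectrum ℝ (M.submatrix e e) = spectrum ℝ M :=
  AlgEquiv.spectrum_eq (Matrix.reindexAlgEquiv ℝ ℝ e.symm) M

/-- The block diagonal matrix of a family of square matrices, as an algebra homomorphism. -/
noncomputable def blockDiagonalAlgHom {o : Type*} [Fintype o] [DecidableEq o] (m : o → Type*)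
    [∀ i, Fintype (m i)] [∀ i, DecidableEq (m i)] :
    (∀ i, Matrix (m i) (m i) ℝ) →ₐ[ℝ] Matrix (Σ i, m i) (Σ i, m i) ℝ :=
  AlgHom.ofLinearMap
    { toFun := Matrix.blockDiagonal'
      map_add' := Matrix.blockDiagonal'_add
      map_smul' := fun c M => Matrix.blockDiagonal'_smul c M }
    Matrix.blockDiagonal'_one Matrix.blockDiagonal'_mul

theorem isSymm_blockDiagonal' {o : Type*} [DecidableEq o] {m : o → Type*}
    {D : ∀ i, Matrix (m i) (m i) ℝ} (hD : ∀ i, (D i).IsSymm) :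
    (Matrix.blockDiagonal' D).IsSymm := by
  rw [Matrix.IsSymm, Matrix.blockDiagonal'_transpose]
  congr 1
  exact funext hD

theorem aeval_blockDiagonal' {o : Type*} [Fintype o] [DecidableEq o] {m : o → Type*}
    [∀ i, Fintype (m i)] [∀ i, DecidableEq (m i)] (D : ∀ i, Matrix (m i) (m i) ℝ) (s : ℝ[X]) :
    aeval (Matrix.blockDiagonal' D) s = Matrix.blockDiagonal' fun i => aeval (D i) s := by
  have h1 := Polynomial.aeval_algHom_apply (blockDiagonalAlgHom m) D s
  have h2 : aeval D s = fun i => aeval (D i) s := by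
    funext i
    exact (Polynomial.aeval_algHom_apply
      (Pi.evalAlgHom ℝ (fun i => Matrix (m i) (m i) ℝ) i) D s).symm
  rw [h2] at h1
  exact h1

theorem spectrum_blockDiagonal'_subset {o : Type*} [Fintype o] [DecidableEq o] {m : o → Type*}
    [∀ i, Fintype (m i)] [∀ i, DecidableEq (m i)] {D : ∀ i, Matrix (m i) (m i) ℝ} {S : Set ℝ}
    (h : ∀ i, spectrum ℝ (D i) ⊆ S) : spectrum ℝ (Matrix.blockDiagonal' D) ⊆ S := by
  refine (AlgHom.spectrum_apply_subset (blockDiagonalAlgHom m) D).trans fun x hx => ?_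
  by_contra hxS
  refine hx (Pi.isUnit_iff.mpr fun i => ?_)
  by_contra hi
  exact hxS (h i hi)

theorem cfc_blockDiagonal' {o : Type*} [Fintype o] [DecidableEq o] {m : o → Type*}
    [∀ i, Fintype (m i)] [∀ i, DecidableEq (m i)] {D : ∀ i, Matrix (m i) (m i) ℝ}
    (hD : ∀ i, (D i).IsSymm) (f : ℝ → ℝ) :
    cfc f (Matrix.blockDiagonal' D) = Matrix.blockDiagonal' fun i => cfc f (D i) := by
  obtain ⟨s, h⟩ := exists_polynomial_eq_on
    (Set.finite_iUnion fun i => finite_spectrum_real (hD i)) f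
  rw [cfc_eq_aeval (isSymm_blockDiagonal' hD) (s := s) fun x hx => h x
    (spectrum_blockDiagonal'_subset (Set.subset_iUnion fun i => spectrum ℝ (D i)) hx),
    aeval_blockDiagonal']
  congr 1
  funext i
  exact (cfc_eq_aeval (hD i) fun x hx => h x (Set.mem_iUnion.mpr ⟨i, hx⟩)).symm

/-- Semidefiniteness, unlike the spectrum itself, visibly survives the congruence `Wᵀ M W`. -/
theorem spectrum_subset_Icc_iff {M : Matrix n n ℝ} (hM : M.IsSymm) {a b : ℝ} :
    spectrum ℝ M ⊆ Set.Icc a b ↔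
      (M - algebraMap ℝ _ a).PosSemidef ∧ (algebraMap ℝ _ b - M).PosSemidef := by
  have hs : ∀ c : ℝ, (algebraMap ℝ (Matrix n n ℝ) c).IsHermitian := fun c => by
    rw [Matrix.algebraMap_eq_diagonal]
    exact Matrix.isHermitian_diagonal _
  have hM' : M.IsHermitian := isSelfAdjoint_of_isSymm hM
  rw [posSemidef_iff_isHermitian_and_spectrum_nonneg,
    posSemidef_iff_isHermitian_and_spectrum_nonneg,
    ← spectrum.sub_singleton_eq, ← spectrum.singleton_sub_eq]
  simp only [hM'.sub (hs a), (hs b).sub hM', true_and, Set.sub_singleton, Set.singleton_sub,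
    Set.image_subset_iff]
  constructor
  · intro h
    exact ⟨fun x hx => sub_nonneg.mpr (h hx).1, fun x hx => sub_nonneg.mpr (h hx).2⟩
  · rintro ⟨h1, h2⟩ x hx
    exact ⟨sub_nonneg.mp (h1 hx), sub_nonneg.mp (h2 hx)⟩

/-- The spectrum of a compression stays in any interval that contains the spectrum. -/
theorem spectrum_compression_subset {M : Matrix n n ℝ} (hM : M.IsSymm) {W : Matrix n p ℝ}
    (hW : OrthonormalCols W) {a b : ℝ} (h : spectrum ℝ M ⊆ Set.Icc a b) :
    spectrum ℝ (Wᵀ * M * W) ⊆ Set.Icc a b := by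
  rw [spectrum_subset_Icc_iff hM] at h
  rw [spectrum_subset_Icc_iff (isSymm_compression hM W)]
  have e : ∀ c : ℝ, Wᵀ * algebraMap ℝ (Matrix n n ℝ) c * W = algebraMap ℝ _ c := fun c => by
    rw [Algebra.algebraMap_eq_smul_one, Algebra.algebraMap_eq_smul_one, Matrix.mul_smul,
      Matrix.smul_mul, Matrix.mul_one, hW]
  have h1 := h.1.conjTranspose_mul_mul_same W
  have h2 := h.2.conjTranspose_mul_mul_same W
  rw [conjTranspose_eq_transpose_of_trivial, Matrix.mul_sub, Matrix.sub_mul, e] at h1 h2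
  exact ⟨h1, h2⟩

theorem spectrum_submatrix_subset {M : Matrix n n ℝ} (hM : M.IsSymm) {e : p → n}
    (he : Function.Injective e) {a b : ℝ} (h : spectrum ℝ M ⊆ Set.Icc a b) :
    spectrum ℝ (M.submatrix e e) ⊆ Set.Icc a b := by
  have := spectrum_compression_subset hM (orthonormalCols_one_submatrix he) h
  rwa [Matrix.transpose_submatrix, Matrix.transpose_one, one_submatrix_id_mul,
    mul_one_submatrix_id, Matrix.submatrix_submatrix] at this

open scoped Matrix.Norms.L2Operator in
theorem norm_conj_le {W : Matrix n p ℝ} (hW : OrthonormalCols W) (M : Matrix p p ℝ) :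
    ‖W * M * Wᵀ‖ ≤ ‖M‖ := by
  have h1 := norm_le_one_of_orthonormalCols hW
  have h2 : ‖Wᵀ‖ ≤ 1 := by
    rw [← conjTranspose_eq_transpose_of_trivial, Matrix.l2_opNorm_conjTranspose]
    exact h1
  calc ‖W * M * Wᵀ‖ ≤ ‖W‖ * ‖M‖ * ‖Wᵀ‖ :=
        (Matrix.l2_opNorm_mul _ _).trans
          (mul_le_mul_of_nonneg_right (Matrix.l2_opNorm_mul _ _) (norm_nonneg _))
    _ ≤ 1 * ‖M‖ * 1 := by gcongr
    _ = ‖M‖ := by ring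

-- In an orthonormal eigenbasis the difference is diagonal, with entries `f - g` at the eigenvalues.
open scoped Matrix.Norms.L2Operator in
theorem norm_cfc_sub_cfc_le {M : Matrix n n ℝ} (hM : M.IsSymm) {f g : ℝ → ℝ} {ε : ℝ} (hε : 0 ≤ ε)
    (h : ∀ x ∈ spectrum ℝ M, |f x - g x| ≤ ε) : ‖cfc f M - cfc g M‖ ≤ ε := by
  have hM' : M.IsHermitian := isSelfAdjoint_of_isSymm hM
  rw [← cfc_sub f g M (continuousOn_spectrum hM f) (continuousOn_spectrum hM g), hM'.cfc_eq,
    Matrix.IsHermitian.cfc, Unitary.conjStarAlgAut_apply]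
  have hU : OrthonormalCols (hM'.eigenvectorUnitary : Matrix n n ℝ) := by
    have := Unitary.coe_star_mul_self hM'.eigenvectorUnitary
    rwa [star_eq_conjTranspose, conjTranspose_eq_transpose_of_trivial] at this
  rw [star_eq_conjTranspose, conjTranspose_eq_transpose_of_trivial]
  refine (norm_conj_le hU _).trans ?_
  rw [Matrix.l2_opNorm_diagonal]
  exact (pi_norm_le_iff_of_nonneg hε).mpr fun i => h _ (hM'.eigenvalues_mem_spectrum_real i)

open scoped Matrix.Norms.L2Operator in
/-- The error of one step of the algorithm. -/
theorem norm_update_error_le {u : Type*} [Fintype u] {D A : Matrix n n ℝ} {W : Matrix n p ℝ}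
    {U : Matrix n u ℝ} {B : Matrix u u ℝ} {P q : ℝ[X]} {κ : ℕ} {a b ε : ℝ} {f : ℝ → ℝ}
    (hAD : A = D + U * B * Uᵀ) (hA : A.IsSymm) (hD : D.IsSymm)
    (hAspec : spectrum ℝ A ⊆ Set.Icc a b) (hDspec : spectrum ℝ D ⊆ Set.Icc a b)
    (hW : OrthonormalCols W) (hP : P.natDegree ≤ κ) (hq : q.natDegree ≤ κ)
    (hq0 : ∀ x ∈ Set.Icc a b, q.eval x ≠ 0)
    (hK : ∀ i < κ, W * Wᵀ * ((aeval D q)⁻¹ * D ^ i * U) = (aeval D q)⁻¹ * D ^ i * U)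
    (hε : 0 ≤ ε) (hf : ∀ x ∈ Set.Icc a b, |f x - P.eval x / q.eval x| ≤ ε) :
    ‖cfc f A - (cfc f D - W * cfc f (Wᵀ * D * W) * Wᵀ + W * cfc f (Wᵀ * A * W) * Wᵀ)‖ ≤ 4 * ε := by
  have hHs := isSymm_compression hD W
  have hGs := isSymm_compression hA W
  have hHspec := spectrum_compression_subset hD hW hDspec
  have hGspec := spectrum_compression_subset hA hW hAspec
  have hunit : ∀ {M : Matrix n n ℝ}, M.IsSymm →
      spectrum ℝ M ⊆ Set.Icc a b → IsUnit (aeval M q) := fun hM h =>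
    isUnit_aeval_of_eval_ne_zero hM fun x hx => hq0 x (h hx)
  have hunit' : ∀ {M : Matrix p p ℝ}, M.IsSymm →
      spectrum ℝ M ⊆ Set.Icc a b → IsUnit (aeval M q) := fun hM h =>
    isUnit_aeval_of_eval_ne_zero hM fun x hx => hq0 x (h hx)
  have hex := rational_update_exact hAD hA.eq hP hq (hunit hD hDspec) (hunit hA hAspec)
    (hunit' hHs hHspec) (hunit' hGs hGspec) hK
  rw [← cfc_rational hA fun x hx => hq0 x (hAspec hx),
    ← cfc_rational hD fun x hx => hq0 x (hDspec hx),
    ← cfc_rational hHs fun x hx => hq0 x (hHspec hx),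
    ← cfc_rational hGs fun x hx => hq0 x (hGspec hx)] at hex
  set r : ℝ → ℝ := fun x => P.eval x / q.eval x
  have e1 := norm_cfc_sub_cfc_le hA hε fun x hx => hf x (hAspec hx)
  have e2 := norm_cfc_sub_cfc_le hD hε fun x hx => hf x (hDspec hx)
  have e3 := (norm_conj_le hW _).trans
    (norm_cfc_sub_cfc_le hHs hε fun x hx => hf x (hHspec hx))
  have e4 := (norm_conj_le hW _).trans
    (norm_cfc_sub_cfc_le hGs hε fun x hx => hf x (hGspec hx))
  -- Subtracting the exact identity `hex` for `r` pairs every `f` with its own `r`; the four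
  -- resulting differences give the constant 4.
  have key : cfc f A - (cfc f D - W * cfc f (Wᵀ * D * W) * Wᵀ + W * cfc f (Wᵀ * A * W) * Wᵀ) =
      (cfc f A - cfc r A) - (cfc f D - cfc r D) +
        W * (cfc f (Wᵀ * D * W) - cfc r (Wᵀ * D * W)) * Wᵀ -
        W * (cfc f (Wᵀ * A * W) - cfc r (Wᵀ * A * W)) * Wᵀ := by
    rw [← sub_eq_zero] at hex ⊢
    rw [← hex]
    simp only [Matrix.mul_sub, Matrix.sub_mul]
    abel
  rw [key]
  calc _ ≤ ε + ε + ε + ε :=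
        (norm_sub_le _ _).trans (add_le_add ((norm_add_le _ _).trans
          (add_le_add ((norm_sub_le _ _).trans (add_le_add e1 e2)) e3)) e4)
    _ = 4 * ε := by ring

end FunctionalCalculus

/-! ### Block index bookkeeping and the passage to the next level. -/

section Blocks

open Matrix

theorem child_inj {ℓ : ℕ} {τ τ' : Fin (2 ^ ℓ)} {b b' : Fin 2} :
    child τ b = child τ' b' ↔ τ = τ' ∧ b = b' :=
  finProdFinEquiv.injective.eq_iff.trans Prod.mk_inj

theorem split_castAdd {ℓ : ℕ} (m : Fin (2 ^ (ℓ + 1)) → ℕ) (τ : Fin (2 ^ ℓ))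
    (i : Fin (m (child τ 0))) : split m ⟨τ, Fin.castAdd _ i⟩ = ⟨child τ 0, i⟩ := by
  simp only [split]
  exact Fin.addCases_left i

theorem split_natAdd {ℓ : ℕ} (m : Fin (2 ^ (ℓ + 1)) → ℕ) (τ : Fin (2 ^ ℓ))
    (i : Fin (m (child τ 1))) : split m ⟨τ, Fin.natAdd _ i⟩ = ⟨child τ 1, i⟩ := by
  simp only [split]
  exact Fin.addCases_right i

theorem split_bijective {ℓ : ℕ} (m : Fin (2 ^ (ℓ + 1)) → ℕ) : Function.Bijective (split m) := by
  constructor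
  · rintro ⟨τ, i⟩ ⟨τ', i'⟩ h
    induction i using Fin.addCases with
    | left i =>
      induction i' using Fin.addCases with
      | left i' =>
        rw [split_castAdd, split_castAdd] at h
        obtain ⟨rfl, -⟩ := child_inj.mp (congrArg Sigma.fst h)
        obtain rfl := eq_of_heq (Sigma.mk.inj h).2
        rfl
      | right i' =>
        rw [split_castAdd, split_natAdd] at h
        exact absurd (child_inj.mp (congrArg Sigma.fst h)).2 (by decide)
    | right i =>
      induction i' using Fin.addCases with
      | left i' =>
        rw [split_castAdd, split_natAdd] at h
        exact absurd (child_inj.mp (congrArg Sigma.fst h)).2 (by decide)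
      | right i' =>
        rw [split_natAdd, split_natAdd] at h
        obtain ⟨rfl, -⟩ := child_inj.mp (congrArg Sigma.fst h)
        obtain rfl := eq_of_heq (Sigma.mk.inj h).2
        rfl
  · rintro ⟨σ, i⟩
    obtain ⟨⟨τ, b⟩, rfl⟩ := finProdFinEquiv.surjective σ
    fin_cases b
    · exact ⟨⟨τ, Fin.castAdd _ i⟩, split_castAdd m τ i⟩
    · exact ⟨⟨τ, Fin.natAdd _ i⟩, split_natAdd m τ i⟩

/-- `split` as an equivalence. -/
noncomputable def splitEquiv {ℓ : ℕ} (m : Fin (2 ^ (ℓ + 1)) → ℕ) :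
    BlockIdx (parentSize m) ≃ BlockIdx m :=
  Equiv.ofBijective (split m) (split_bijective m)

/-- The family of the block diagonal matrices of the blocks of any two siblings. -/
def mergeDiag {ℓ : ℕ} {m p : Fin (2 ^ (ℓ + 1)) → ℕ} (Y : ∀ σ, Matrix (Fin (m σ)) (Fin (p σ)) ℝ)
    (τ : Fin (2 ^ ℓ)) : Matrix (Fin (parentSize m τ)) (Fin (parentSize p τ)) ℝ :=
  diag2 (Y (child τ 0)) (Y (child τ 1))

/-- Merging siblings only regroups indices: the zero blocks inside a merged block are off-diagonal
blocks of the finer partition. -/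
theorem blockDiagonal'_mergeDiag {ℓ : ℕ} {m p : Fin (2 ^ (ℓ + 1)) → ℕ}
    (Y : ∀ σ, Matrix (Fin (m σ)) (Fin (p σ)) ℝ) :
    Matrix.blockDiagonal' (mergeDiag Y) =
      (Matrix.blockDiagonal' Y).submatrix (split m) (split p) := by
  ext ⟨τ, i⟩ ⟨τ', j⟩
  rw [Matrix.submatrix_apply]
  by_cases hτ : τ = τ'
  · subst hτ
    have h01 : child τ 0 ≠ child τ 1 := fun h => absurd (child_inj.mp h).2 (by decide)
    rw [Matrix.blockDiagonal'_apply_eq]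
    induction i using Fin.addCases with
    | left i =>
      induction j using Fin.addCases with
      | left j =>
        rw [split_castAdd, split_castAdd, Matrix.blockDiagonal'_apply_eq]
        simp [mergeDiag, diag2]
      | right j =>
        rw [split_castAdd, split_natAdd, Matrix.blockDiagonal'_apply_ne _ _ _ h01]
        simp [mergeDiag, diag2]
    | right i =>
      induction j using Fin.addCases with
      | left j =>
        rw [split_castAdd, split_natAdd, Matrix.blockDiagonal'_apply_ne _ _ _ h01.symm]
        simp [mergeDiag, diag2]
      | right j =>
        rw [split_natAdd, split_natAdd, Matrix.blockDiagonal'_apply_eq]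
        simp [mergeDiag, diag2]
  · have hne : ∀ b c : Fin 2, child τ b ≠ child τ' c := fun b c h => hτ (child_inj.mp h).1
    rw [Matrix.blockDiagonal'_apply_ne _ _ _ hτ]
    induction i using Fin.addCases with
    | left i =>
      induction j using Fin.addCases with
      | left j =>
        rw [split_castAdd, split_castAdd, Matrix.blockDiagonal'_apply_ne _ _ _ (hne _ _)]
      | right j =>
        rw [split_castAdd, split_natAdd, Matrix.blockDiagonal'_apply_ne _ _ _ (hne _ _)]
    | right i =>
      induction j using Fin.addCases with
      | left j =>
        rw [split_castAdd, split_natAdd, Matrix.blockDiagonal'_apply_ne _ _ _ (hne _ _)]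
      | right j =>
        rw [split_natAdd, split_natAdd, Matrix.blockDiagonal'_apply_ne _ _ _ (hne _ _)]

theorem orthonormalCols_blkdiagU {ℓ : ℕ} {s p : Fin (2 ^ (ℓ + 1)) → ℕ}
    {W : ∀ τ, Matrix (Fin (s τ)) (Fin (p τ)) ℝ} (hW : ∀ τ, OrthonormalCols (W τ)) :
    OrthonormalCols (blkdiagU W) := by
  rw [OrthonormalCols, blkdiagU, Matrix.transpose_submatrix, Matrix.blockDiagonal'_transpose,
    ← Matrix.submatrix_mul _ _ (split p) id (split p) Function.bijective_id,
    ← Matrix.blockDiagonal'_mul]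
  have : (fun k => (W k)ᵀ * W k) = 1 := funext hW
  rw [this, Matrix.blockDiagonal'_one]
  exact Matrix.submatrix_one_equiv (splitEquiv p)

theorem blkdiagU_mul_mul_transpose {ℓ : ℕ} {s p : Fin (2 ^ (ℓ + 1)) → ℕ}
    (W : ∀ τ, Matrix (Fin (s τ)) (Fin (p τ)) ℝ) (M : Matrix (BlockIdx p) (BlockIdx p) ℝ) :
    blkdiagU W * M.submatrix (split p) (split p) * (blkdiagU W)ᵀ =
      Matrix.blockDiagonal' W * M * (Matrix.blockDiagonal' W)ᵀ := by
  rw [blkdiagU, Matrix.transpose_submatrix,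
    ← Matrix.submatrix_mul _ _ id _ _ (split_bijective p),
    ← Matrix.submatrix_mul _ _ id _ _ (split_bijective p), Matrix.submatrix_id_id]

theorem blkdiagU_transpose_mul {ℓ : ℕ} {s m p : Fin (2 ^ (ℓ + 1)) → ℕ}
    (W : ∀ τ, Matrix (Fin (s τ)) (Fin (p τ)) ℝ) (Z : ∀ τ, Matrix (Fin (s τ)) (Fin (m τ)) ℝ) :
    (blkdiagU W)ᵀ * blkdiagU Z =
      Matrix.blockDiagonal' (mergeDiag fun σ => (W σ)ᵀ * Z σ) := by
  rw [blockDiagonal'_mergeDiag, blkdiagU, blkdiagU,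
    Matrix.transpose_submatrix, Matrix.blockDiagonal'_transpose,
    ← Matrix.submatrix_mul _ _ _ id _ Function.bijective_id, ← Matrix.blockDiagonal'_mul]

theorem blkdiagU_compression {ℓ : ℕ} {s p : Fin (2 ^ (ℓ + 1)) → ℕ}
    (W : ∀ τ, Matrix (Fin (s τ)) (Fin (p τ)) ℝ) (D : ∀ τ, Matrix (Fin (s τ)) (Fin (s τ)) ℝ) :
    (blkdiagU W)ᵀ * Matrix.blockDiagonal' D * blkdiagU W =
      (Matrix.blockDiagonal' fun τ => (W τ)ᵀ * D τ * W τ).submatrix (split p) (split p) := by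
  rw [blkdiagU, Matrix.transpose_submatrix, Matrix.blockDiagonal'_transpose,
    ← Matrix.submatrix_id_id (Matrix.blockDiagonal' D),
    ← Matrix.submatrix_mul _ _ _ id _ Function.bijective_id,
    ← Matrix.submatrix_mul _ _ _ id _ Function.bijective_id, ← Matrix.blockDiagonal'_mul,
    ← Matrix.blockDiagonal'_mul]

theorem blockDiagonal'_mul_blkdiagU {ℓ : ℕ} {s s' m : Fin (2 ^ (ℓ + 1)) → ℕ}
    (E : ∀ τ, Matrix (Fin (s' τ)) (Fin (s τ)) ℝ) (U : ∀ τ, Matrix (Fin (s τ)) (Fin (m τ)) ℝ) :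
    Matrix.blockDiagonal' E * blkdiagU U = blkdiagU fun τ => E τ * U τ := by
  rw [blkdiagU, blkdiagU, ← Matrix.submatrix_id_id (Matrix.blockDiagonal' E),
    ← Matrix.submatrix_mul _ _ _ id _ Function.bijective_id, ← Matrix.blockDiagonal'_mul]

theorem toMatrix_updateLeaves {L : ℕ} {s s' : Fin (2 ^ L) → ℕ} (t : TelDecomp L s)
    (E : ∀ τ, Matrix (Fin (s' τ)) (Fin (s τ)) ℝ) (F : ∀ τ, Matrix (Fin (s' τ)) (Fin (s' τ)) ℝ) :
    (t.updateLeaves E F).toMatrix =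
      Matrix.blockDiagonal' F +
        Matrix.blockDiagonal' E * t.toMatrix * (Matrix.blockDiagonal' E)ᵀ := by
  have hD : ∀ D : ∀ τ, Matrix (Fin (s τ)) (Fin (s τ)) ℝ,
      (Matrix.blockDiagonal' fun τ => F τ + E τ * D τ * (E τ)ᵀ) =
        Matrix.blockDiagonal' F +
          Matrix.blockDiagonal' E * Matrix.blockDiagonal' D * (Matrix.blockDiagonal' E)ᵀ := by
    intro D
    rw [Matrix.blockDiagonal'_transpose, ← Matrix.blockDiagonal'_mul,
      ← Matrix.blockDiagonal'_mul, ← Matrix.blockDiagonal'_add]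
    rfl
  cases t with
  | root _ D => exact hD D
  | level _ m D U up =>
    simp only [TelDecomp.updateLeaves, TelDecomp.toMatrix]
    rw [hD, ← blockDiagonal'_mul_blkdiagU]
    simp only [Matrix.mul_add, Matrix.add_mul, Matrix.transpose_mul, Matrix.mul_assoc, add_assoc]

/-- A block diagonal `E` does not mix blocks, so off-diagonal blocks of `M` never reach a diagonal
one. -/
theorem blockDiag'_conj {N : ℕ} {s s' : Fin N → ℕ} (E : ∀ τ, Matrix (Fin (s' τ)) (Fin (s τ)) ℝ)
    (M : Matrix (BlockIdx s) (BlockIdx s) ℝ) (τ : Fin N) :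
    (Matrix.blockDiagonal' E * M * (Matrix.blockDiagonal' E)ᵀ).blockDiag' τ =
      E τ * M.blockDiag' τ * (E τ)ᵀ := by
  ext i j
  simp [Matrix.mul_apply, Fintype.sum_sigma, Matrix.blockDiag'_apply, Matrix.blockDiagonal'_apply,
    Finset.sum_dite_irrel]

/-- The update acts on each diagonal block separately. This keeps every later `D̃ τ` a diagonal
block of the compressed matrix, which confines its spectrum. -/
theorem isStandard_updateLeaves {L : ℕ} {s s' : Fin (2 ^ L) → ℕ} {t : TelDecomp L s}
    (ht : t.IsStandard) (E : ∀ τ, Matrix (Fin (s' τ)) (Fin (s τ)) ℝ)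
    (F : ∀ τ, Matrix (Fin (s' τ)) (Fin (s' τ)) ℝ) : (t.updateLeaves E F).IsStandard := by
  cases t with
  | root => trivial
  | level _ m D U up =>
    refine ⟨fun τ => ?_, ht.2⟩
    have h := toMatrix_updateLeaves (TelDecomp.level _ m D U up) E F
    simp only [TelDecomp.updateLeaves] at h
    rw [h, Matrix.blockDiag'_add, Pi.add_apply, blockDiag'_conj, ht.1 τ,
      Matrix.blockDiag'_blockDiagonal']

end Blocks

/-! ### Krylov spaces of the blocks and induction over the levels. -/

section Krylov

open Matrix

theorem natDegree_poleDenom_le {k : ℕ} (ξ : Fin k → OnePoint ℂ) :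
    (poleDenom ξ).natDegree ≤ k := by
  refine (natDegree_prod_le _ _).trans ?_
  calc ∑ j, ((ξ j).elim 1 fun z => X - C z : ℂ[X]).natDegree ≤ ∑ _j : Fin k, 1 := by
        refine Finset.sum_le_sum fun j _ => ?_
        induction ξ j using OnePoint.rec <;> simp
    _ = k := by simp

theorem poleDenom_ne_zero {k : ℕ} (ξ : Fin k → OnePoint ℂ) : poleDenom ξ ≠ 0 := by
  refine Finset.prod_ne_zero_iff.mpr fun j _ => ?_
  induction ξ j using OnePoint.rec <;> simp [X_sub_C_ne_zero]

/-- The denominator belonging to a list of poles that is closed under conjugation is real. -/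
theorem exists_real_poleDenom {k : ℕ} {ξ : Fin k → OnePoint ℂ} (hξ : ConjClosed ξ) :
    ∃ Q : ℝ[X], Q.map (algebraMap ℝ ℂ) = poleDenom ξ := by
  obtain ⟨σ, hσ⟩ := hξ
  have hconj : (poleDenom ξ).map (starRingEnd ℂ) = poleDenom ξ := by
    rw [poleDenom, Polynomial.map_prod, ← Equiv.prod_comp σ (fun j => (ξ j).elim 1 _)]
    refine Finset.prod_congr rfl fun j _ => ?_
    rw [hσ j]
    induction ξ j using OnePoint.rec <;> simp
  have hl : poleDenom ξ ∈ Polynomial.lifts (algebraMap ℝ ℂ) := by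
    rw [Polynomial.lifts_iff_coeff_lifts]
    intro i
    have := congrArg (fun s => s.coeff i) hconj
    simp only [Polynomial.coeff_map] at this
    obtain ⟨r, hr⟩ := Complex.conj_eq_iff_real.mp this
    exact ⟨r, hr.symm⟩
  exact (Polynomial.mem_lifts _).mp hl

theorem isUnit_aeval_poleDenom {n k : ℕ} {M : Matrix (Fin n) (Fin n) ℝ} {ξ : Fin k → OnePoint ℂ}
    (h : PolesAdmissible M ξ) : IsUnit (aeval (toC M) (poleDenom ξ)) := by
  refine Finset.prod_induction _ (fun s => IsUnit (aeval (toC M) s)) (fun s t hs ht => ?_) ?_ ?_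
  · rw [map_mul]; exact hs.mul ht
  · simp
  · intro j _
    induction hj : ξ j using OnePoint.rec with
    | infty => simp
    | coe z =>
      have hz : z ∉ spectrum ℂ (toC M) := fun hz => h z hz j hj
      rw [spectrum.notMem_iff] at hz
      rw [OnePoint.elim_some, map_sub, aeval_X, aeval_C, ← neg_sub]
      exact hz.neg

theorem toC_mul {l m n : Type*} [Fintype m] (M : Matrix l m ℝ) (N : Matrix m n ℝ) :
    toC (M * N) = toC M * toC N :=
  Matrix.map_mul (f := Complex.ofRealHom)

theorem toC_aeval {n : ℕ} (M : Matrix (Fin n) (Fin n) ℝ) (Q : ℝ[X]) :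
    toC (aeval M Q) = aeval (toC M) (Q.map (algebraMap ℝ ℂ)) := by
  rw [Polynomial.aeval_map_algebraMap]
  exact (Polynomial.aeval_algHom_apply
    (AlgHom.mapMatrix (m := Fin n) (Algebra.ofId ℝ ℂ)) M Q).symm

theorem isUnit_of_isUnit_toC {n : ℕ} {M : Matrix (Fin n) (Fin n) ℝ} (h : IsUnit (toC M)) :
    IsUnit M := by
  rw [Matrix.isUnit_iff_isUnit_det, isUnit_iff_ne_zero] at h ⊢
  intro h0
  refine h ?_
  have : (toC M).det = ((M.det : ℝ) : ℂ) := (RingHom.map_det Complex.ofRealHom M).symm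
  rw [this, h0, Complex.ofReal_zero]

theorem toC_inv {n : ℕ} {M : Matrix (Fin n) (Fin n) ℝ} (h : IsUnit M) :
    (toC M)⁻¹ = toC M⁻¹ := by
  refine Matrix.inv_eq_right_inv ?_
  rw [← toC_mul, Matrix.mul_nonsing_inv _ ((Matrix.isUnit_iff_isUnit_det _).mp h)]
  exact Matrix.map_one _ Complex.ofReal_zero Complex.ofReal_one

/-- The rational Krylov space contains the one that belongs to a factor of the denominator and a
correspondingly lower degree. -/
theorem mem_ratKrylov {n c k κ : ℕ} {M : Matrix (Fin n) (Fin n) ℝ} {B : Matrix (Fin n) (Fin c) ℝ}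
    {ξ : Fin k → OnePoint ℂ} (hM : PolesAdmissible M ξ) {g q : ℝ[X]}
    (hgq : (g * q).map (algebraMap ℝ ℂ) = poleDenom ξ) (hdeg : g.natDegree + κ ≤ k) {i : ℕ}
    (hi : i < κ) : (aeval M q)⁻¹ * M ^ i * B ∈ ratKrylov M B ξ := by
  have hu : IsUnit (aeval M (g * q)) := by
    refine isUnit_of_isUnit_toC ?_
    rw [toC_aeval, hgq]
    exact isUnit_aeval_poleDenom hM
  -- Expanding by `g` turns `q(M)⁻¹ M ^ i` into `(g q)(M)⁻¹` times the polynomial `g X ^ i`, of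
  -- degree below `k`; its coefficients, as scalar matrices, are the `K j`.
  have hinv : (aeval M q)⁻¹ = (aeval M (g * q))⁻¹ * aeval M g := by
    refine Matrix.inv_eq_left_inv ?_
    rw [Matrix.mul_assoc, ← map_mul, aeval_inv_mul hu]
  have hd : (g * X ^ i).natDegree < k := by
    refine lt_of_le_of_lt natDegree_mul_le ?_
    rw [natDegree_X_pow]
    omega
  refine ⟨fun j => (g * X ^ i).coeff j • (1 : Matrix (Fin c) (Fin c) ℝ), ?_⟩
  have hsum : ∑ j : Fin k, M ^ (j : ℕ) * B *
      ((g * X ^ i).coeff j • (1 : Matrix (Fin c) (Fin c) ℝ)) =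
      aeval M (g * X ^ i) * B := by
    rw [aeval_eq_sum_range' hd, Matrix.sum_mul, Finset.sum_range]
    simp only [Matrix.mul_smul, Matrix.smul_mul, Matrix.mul_one]
  rw [hsum, ← hgq, ← toC_aeval, toC_inv hu, ← toC_mul, hinv,
    map_mul (aeval M) g (X ^ i), map_pow, aeval_X]
  simp only [Matrix.mul_assoc]

/-- `W * Wᵀ` is the orthogonal projection onto the column span of `W`. -/
theorem mul_transpose_mul_eq_of_mem {n c p : ℕ} {W : Matrix (Fin n) (Fin p) ℝ}
    {Q : Set (Matrix (Fin n) (Fin c) ℝ)} (hW : IsOrthonormalBasisOf W Q)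
    {Y : Matrix (Fin n) (Fin c) ℝ} (hY : Y ∈ Q) : W * Wᵀ * Y = Y := by
  have hcol : ∀ j, (W * Wᵀ) *ᵥ Y.col j = Y.col j := by
    intro j
    have hmem : Y.col j ∈ Submodule.span ℝ (Set.range W.col) := by
      rw [hW.2]
      exact Submodule.subset_span ⟨Y, hY, j, rfl⟩
    rw [← Matrix.range_mulVecLin] at hmem
    obtain ⟨v, hv⟩ := hmem
    rw [Matrix.mulVecLin_apply] at hv
    have hWW : Wᵀ * W = 1 := hW.1
    rw [← hv, Matrix.mulVec_mulVec, Matrix.mul_assoc, hWW, Matrix.mul_one]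
  ext i j
  exact congrFun (hcol j) i

/-- All factors are block diagonal, so the nodewise Krylov bases give the projection hypothesis of
the update lemmas for the whole level. -/
theorem blkdiagU_krylov {ℓ k κ : ℕ} {s m p : Fin (2 ^ (ℓ + 1)) → ℕ}
    {D : ∀ τ, Matrix (Fin (s τ)) (Fin (s τ)) ℝ} {Z : ∀ τ, Matrix (Fin (s τ)) (Fin (m τ)) ℝ}
    {W : ∀ τ, Matrix (Fin (s τ)) (Fin (p τ)) ℝ} {ξ : Fin k → OnePoint ℂ}
    (poles : ∀ τ, PolesAdmissible (D τ) ξ)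
    (basis : ∀ τ, IsOrthonormalBasisOf (W τ) (ratKrylov (D τ) (Z τ) ξ)) {g q : ℝ[X]}
    (hgq : (g * q).map (algebraMap ℝ ℂ) = poleDenom ξ) (hdeg : g.natDegree + κ ≤ k)
    (hunit : ∀ τ, IsUnit (aeval (D τ) q)) {i : ℕ} (hi : i < κ) :
    blkdiagU W * (blkdiagU W)ᵀ *
        ((aeval (Matrix.blockDiagonal' D) q)⁻¹ * Matrix.blockDiagonal' D ^ i * blkdiagU Z) =
      (aeval (Matrix.blockDiagonal' D) q)⁻¹ * Matrix.blockDiagonal' D ^ i * blkdiagU Z := by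
  have hinv : (aeval (Matrix.blockDiagonal' D) q)⁻¹ =
      Matrix.blockDiagonal' fun τ => (aeval (D τ) q)⁻¹ := by
    refine Matrix.inv_eq_left_inv ?_
    rw [aeval_blockDiagonal', ← Matrix.blockDiagonal'_mul, ← Matrix.blockDiagonal'_one]
    congr 1
    exact funext fun τ => aeval_inv_mul (hunit τ)
  have hWW : blkdiagU W * (blkdiagU W)ᵀ = Matrix.blockDiagonal' fun τ => W τ * (W τ)ᵀ := by
    have h1 : (1 : Matrix (BlockIdx p) (BlockIdx p) ℝ).submatrix (split p) (split p) = 1 :=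
      Matrix.submatrix_one_equiv (splitEquiv p)
    have := blkdiagU_mul_mul_transpose W 1
    rw [h1, Matrix.mul_one, Matrix.mul_one] at this
    rw [this, Matrix.blockDiagonal'_transpose, ← Matrix.blockDiagonal'_mul]
  rw [hinv, hWW, ← Matrix.blockDiagonal'_pow, ← Matrix.blockDiagonal'_mul,
    blockDiagonal'_mul_blkdiagU, blockDiagonal'_mul_blkdiagU]
  congr 1
  funext τ
  exact mul_transpose_mul_eq_of_mem (basis τ) (mem_ratKrylov (poles τ) hgq hdeg hi)

theorem blockDiagonal'_correction {ℓ : ℕ} {s p : Fin (2 ^ (ℓ + 1)) → ℕ}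
    {D : ∀ τ, Matrix (Fin (s τ)) (Fin (s τ)) ℝ} (hD : ∀ τ, (D τ).IsSymm)
    (W : ∀ τ, Matrix (Fin (s τ)) (Fin (p τ)) ℝ) (f : ℝ → ℝ) :
    (Matrix.blockDiagonal' fun τ => cfc f (D τ) - W τ * cfc f ((W τ)ᵀ * D τ * W τ) * (W τ)ᵀ) =
      cfc f (Matrix.blockDiagonal' D) - blkdiagU W *
        cfc f ((blkdiagU W)ᵀ * Matrix.blockDiagonal' D * blkdiagU W) * (blkdiagU W)ᵀ := by
  have hH : ∀ τ, ((W τ)ᵀ * D τ * W τ).IsSymm := fun τ => isSymm_compression (hD τ) (W τ)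
  have hcfc := cfc_submatrix_equiv (isSymm_blockDiagonal' hH) f (splitEquiv p)
  rw [show ⇑(splitEquiv p) = split p from rfl] at hcfc
  rw [blkdiagU_compression, hcfc, blkdiagU_mul_mul_transpose, cfc_blockDiagonal' hD,
    cfc_blockDiagonal' hH, Matrix.blockDiagonal'_transpose, ← Matrix.blockDiagonal'_mul,
    ← Matrix.blockDiagonal'_mul, ← Matrix.blockDiagonal'_sub]
  rfl

/-- Closes the recursion: the algorithm continues with the compression whose function the update
formula leaves to be computed. -/
theorem toMatrix_next {L : ℕ} {s m p : Fin (2 ^ (L + 1)) → ℕ}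
    (D : ∀ τ, Matrix (Fin (s τ)) (Fin (s τ)) ℝ) (Z : ∀ τ, Matrix (Fin (s τ)) (Fin (m τ)) ℝ)
    (up : TelDecomp L (parentSize m)) (W : ∀ τ, Matrix (Fin (s τ)) (Fin (p τ)) ℝ) :
    (up.updateLeaves (mergeDiag fun σ => (W σ)ᵀ * Z σ)
      (mergeDiag fun σ => (W σ)ᵀ * D σ * W σ)).toMatrix =
      (blkdiagU W)ᵀ * (TelDecomp.level s m D Z up).toMatrix * blkdiagU W := by
  rw [toMatrix_updateLeaves, ← blkdiagU_transpose_mul, blockDiagonal'_mergeDiag,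
    ← blkdiagU_compression, TelDecomp.toMatrix]
  simp only [Matrix.mul_add, Matrix.add_mul, Matrix.transpose_mul, Matrix.transpose_transpose,
    Matrix.mul_assoc]

open scoped Matrix.Norms.L2Operator in
/-- The error bound for the matrices on the block index sets. -/
theorem norm_cfc_toMatrix_sub_le {k κ : ℕ} {ξ : Fin k → OnePoint ℂ} {f : ℝ → ℝ} {P g q : ℝ[X]}
    {a b ε : ℝ} (hgq : (g * q).map (algebraMap ℝ ℂ) = poleDenom ξ)
    (hdeg : g.natDegree + κ ≤ k) (hP : P.natDegree ≤ κ) (hq : q.natDegree ≤ κ)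
    (hq0 : ∀ x ∈ Set.Icc a b, q.eval x ≠ 0) (hε : 0 ≤ ε)
    (hf : ∀ x ∈ Set.Icc a b, |f x - P.eval x / q.eval x| ≤ ε)
    {L : ℕ} {s : Fin (2 ^ L) → ℕ} {t out : TelDecomp L s} (run : AlgorithmRun f ξ t out)
    (hstd : t.IsStandard) (hsymm : t.toMatrix.IsSymm)
    (hspec : spectrum ℝ t.toMatrix ⊆ Set.Icc a b) :
    ‖cfc f t.toMatrix - out.toMatrix‖ ≤ 4 * L * ε := by
  induction run with
  | root s D =>
    have hD : ∀ τ, (D τ).IsSymm := fun τ => by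
      have := congrFun (Matrix.blockDiag'_blockDiagonal' D) τ
      rw [← this]
      exact hsymm.submatrix (Sigma.mk τ)
    -- At the root `f` is evaluated exactly.
    rw [TelDecomp.toMatrix, TelDecomp.toMatrix, cfc_blockDiagonal' hD, sub_self, norm_zero]
    positivity
  | @level L s m p D Z up W out poles basis next ih =>
    have hblk : ∀ τ, (TelDecomp.level s m D Z up).toMatrix.submatrix (Sigma.mk τ) (Sigma.mk τ) =
        D τ := hstd.1
    have hDs : ∀ τ, (D τ).IsSymm := fun τ => by
      rw [← hblk τ]
      exact hsymm.submatrix (Sigma.mk τ)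
    have hDspec : ∀ τ, spectrum ℝ (D τ) ⊆ Set.Icc a b := fun τ => by
      rw [← hblk τ]
      exact spectrum_submatrix_subset hsymm sigma_mk_injective hspec
    have hW := orthonormalCols_blkdiagU fun τ => (basis τ).1
    have hnext := toMatrix_next D Z up W
    have hstep := norm_update_error_le (W := blkdiagU W) (f := f) rfl hsymm
      (isSymm_blockDiagonal' hDs) hspec (spectrum_blockDiagonal'_subset hDspec) hW hP hq hq0
      (fun i hi => blkdiagU_krylov poles basis hgq hdeg (fun τ =>
        isUnit_aeval_of_eval_ne_zero (hDs τ) fun x hx => hq0 x (hDspec τ hx)) hi) hε hf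
    have hrec : ‖cfc f ((blkdiagU W)ᵀ * (TelDecomp.level s m D Z up).toMatrix * blkdiagU W) -
        out.toMatrix‖ ≤ 4 * L * ε := by
      rw [← hnext]
      refine ih (isStandard_updateLeaves hstd.2 _ _) ?_ ?_
      · exact hnext ▸ isSymm_compression hsymm _
      · exact hnext ▸ spectrum_compression_subset hsymm hW hspec
    have hconj := (norm_conj_le hW _).trans hrec
    -- The error splits into that of the update formula with exact `f(Wᵀ A W)` and the conjugated
    -- error of the levels above.
    have key : cfc f (TelDecomp.level s m D Z up).toMatrix - (TelDecomp.level s p (fun τ =>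
        cfc f (D τ) - W τ * cfc f ((W τ)ᵀ * D τ * W τ) * (W τ)ᵀ) W out).toMatrix =
        (cfc f (TelDecomp.level s m D Z up).toMatrix -
          (cfc f (Matrix.blockDiagonal' D) - blkdiagU W *
            cfc f ((blkdiagU W)ᵀ * Matrix.blockDiagonal' D * blkdiagU W) * (blkdiagU W)ᵀ +
          blkdiagU W * cfc f ((blkdiagU W)ᵀ * (TelDecomp.level s m D Z up).toMatrix *
            blkdiagU W) * (blkdiagU W)ᵀ)) +
        blkdiagU W * (cfc f ((blkdiagU W)ᵀ * (TelDecomp.level s m D Z up).toMatrix *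
            blkdiagU W) - out.toMatrix) * (blkdiagU W)ᵀ := by
      conv_lhs => enter [2]; rw [TelDecomp.toMatrix]
      rw [blockDiagonal'_correction hDs, Matrix.mul_sub, Matrix.sub_mul]
      abel
    rw [key]
    refine (norm_add_le _ _).trans ((add_le_add hstep hconj).trans_eq ?_)
    push_cast
    ring

-- Reindexing is conjugation by a permutation matrix.
open scoped Matrix.Norms.L2Operator in
theorem norm_submatrix_equiv_le {m n : Type*} [Fintype m] [DecidableEq m] [Fintype n]
    [DecidableEq n] (M : Matrix n n ℝ) (e : m ≃ n) : ‖M.submatrix e e‖ ≤ ‖M‖ := by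
  have h := norm_conj_le (orthonormalCols_one_submatrix e.symm.injective) M
  have he : (1 : Matrix m m ℝ).submatrix id e.symm = (1 : Matrix n n ℝ).submatrix e id := by
    ext i j
    simp [Matrix.one_apply, Equiv.eq_symm_apply]
  rwa [he, Matrix.transpose_submatrix, Matrix.transpose_one, one_submatrix_id_mul,
    mul_one_submatrix_id, Matrix.submatrix_submatrix] at h

theorem norm2_cfc_sub_matrixOf_le {n k κ : ℕ} {ξ : Fin k → OnePoint ℂ} {f : ℝ → ℝ} {P g q : ℝ[X]}
    {a b ε : ℝ} (hgq : (g * q).map (algebraMap ℝ ℂ) = poleDenom ξ)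
    (hdeg : g.natDegree + κ ≤ k) (hP : P.natDegree ≤ κ) (hq : q.natDegree ≤ κ)
    (hq0 : ∀ x ∈ Set.Icc a b, q.eval x ≠ 0) (hε : 0 ≤ ε)
    (hf : ∀ x ∈ Set.Icc a b, |f x - P.eval x / q.eval x| ≤ ε)
    {L : ℕ} (T : ClusterTree n L) {t out : TelDecomp L T.leafSize} (run : AlgorithmRun f ξ t out)
    (hstd : t.IsStandard) (hsymm : (T.matrixOf t).IsSymm)
    (hspec : spectrum ℝ (T.matrixOf t) ⊆ Set.Icc a b) :
    norm2 (cfc f (T.matrixOf t) - T.matrixOf out) ≤ 4 * L * ENNReal.ofReal ε := by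
  have hback : (T.matrixOf t).submatrix T.enum T.enum = t.toMatrix := by
    ext i j
    simp [ClusterTree.matrixOf]
  have hs : t.toMatrix.IsSymm := hback ▸ hsymm.submatrix T.enum
  have hsp : spectrum ℝ t.toMatrix ⊆ Set.Icc a b := by
    rw [← hback, spectrum_submatrix_equiv]
    exact hspec
  have hmain := norm_cfc_toMatrix_sub_le hgq hdeg hP hq hq0 hε hf run hstd hs hsp
  have hcfc : cfc f (T.matrixOf t) - T.matrixOf out =
      (cfc f t.toMatrix - out.toMatrix).submatrix T.enum.symm T.enum.symm := by
    rw [Matrix.submatrix_sub]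
    exact congrArg (· - T.matrixOf out) (cfc_submatrix_equiv hs f T.enum.symm)
  have hle := (norm_submatrix_equiv_le (cfc f t.toMatrix - out.toMatrix) T.enum.symm).trans hmain
  rw [← hcfc] at hle
  have h4 : (4 * L * ENNReal.ofReal ε : ENNReal) = ENNReal.ofReal (4 * L * ε) := by
    rw [ENNReal.ofReal_mul (by positivity), ENNReal.ofReal_mul (by positivity)]
    simp
  rw [h4, norm2, ← ofReal_norm]
  exact ENNReal.ofReal_le_ofReal hle

end Krylov

/-! ### Best rational approximation when poles may lie in the interval. -/

section Approximation

/-- Splitting off the zeros in a given set from a real polynomial. -/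
theorem exists_factor_roots (I : Set ℝ) (Q : ℝ[X]) (hQ : Q ≠ 0) :
    ∃ g q : ℝ[X], g * q = Q ∧ (∀ x ∈ I, q.eval x ≠ 0) ∧
      ∀ z : ℂ, (g.map (algebraMap ℝ ℂ)).eval z = 0 → ∃ x ∈ I, z = (x : ℂ) := by
  induction hd : Q.natDegree using Nat.strong_induction_on generalizing Q with
  | _ d ih =>
    by_cases h : ∃ x ∈ I, Q.eval x = 0
    · obtain ⟨x, hx, hx0⟩ := h
      obtain ⟨R, rfl⟩ := dvd_iff_isRoot.mpr hx0
      have hR : R ≠ 0 := right_ne_zero_of_mul hQ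
      have hlt : R.natDegree < d := by
        rw [← hd, natDegree_mul (X_sub_C_ne_zero x) hR, natDegree_X_sub_C]
        omega
      obtain ⟨g, q, hgq, hq, hg⟩ := ih _ hlt R hR rfl
      refine ⟨(X - C x) * g, q, by rw [mul_assoc, hgq], hq, fun z hz => ?_⟩
      rw [Polynomial.map_mul, eval_mul, mul_eq_zero] at hz
      rcases hz with hz | hz
      · refine ⟨x, hx, ?_⟩
        simpa [sub_eq_zero] using hz
      · exact hg z hz
    · push Not at h
      exact ⟨1, Q, one_mul Q, h, fun z hz => by simp at hz⟩

/-- The reduced denominator divides `q`, so it does not vanish at `x` either. -/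
theorem evalAt_div {p q : ℂ[X]} {x : ℝ} (hq : q.eval (x : ℂ) ≠ 0) :
    evalAt (algebraMap ℂ[X] (RatFunc ℂ) p / algebraMap ℂ[X] (RatFunc ℂ) q) x =
      p.eval (x : ℂ) / q.eval (x : ℂ) := by
  set r := algebraMap ℂ[X] (RatFunc ℂ) p / algebraMap ℂ[X] (RatFunc ℂ) q with hr
  have hq0 : q ≠ 0 := fun h => hq (by rw [h, eval_zero])
  have hcross := (RatFunc.num_mul_eq_mul_denom_iff hq0).mpr hr
  have hden : r.denom.eval (x : ℂ) ≠ 0 := fun h => hq (eval_eq_zero_of_dvd_of_eval_eq_zero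
    (RatFunc.denom_div_dvd p q) h)
  have h := congrArg (eval (x : ℂ)) hcross
  rw [eval_mul, eval_mul] at h
  rw [evalAt, RatFunc.eval, eval₂_id, eval₂_id, div_eq_div_iff hden hq, h]

theorem div_mem_ratSpace {k κ : ℕ} {ξ : Fin k → OnePoint ℂ} {g q : ℂ[X]}
    (hgq : g * q = poleDenom ξ) (hdeg : g.natDegree + κ ≤ k) {p : ℂ[X]}
    (hp : p.degree < (κ : WithBot ℕ)) :
    algebraMap ℂ[X] (RatFunc ℂ) p / algebraMap ℂ[X] (RatFunc ℂ) q ∈ ratSpace ξ := by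
  have h0 := poleDenom_ne_zero ξ
  rw [← hgq] at h0
  have hg : algebraMap ℂ[X] (RatFunc ℂ) g ≠ 0 := RatFunc.algebraMap_ne_zero (left_ne_zero_of_mul h0)
  refine ⟨g * p, ?_, ?_⟩
  · rw [degree_mul, degree_eq_natDegree (left_ne_zero_of_mul h0)]
    calc (g.natDegree : WithBot ℕ) + p.degree < g.natDegree + κ :=
          WithBot.add_lt_add_left (WithBot.coe_ne_bot) hp
      _ ≤ k := by exact_mod_cast hdeg
  · rw [← hgq, map_mul, map_mul, mul_div_mul_left _ _ hg]

/-- The reduced denominator has no zero in common with `g`, hence is coprime to it and divides `q`;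
the factor `g` then cancels and lowers the degree bound by `deg g`. -/
theorem exists_eq_div_of_denom_ne_zero {k : ℕ} {ξ : Fin k → OnePoint ℂ} {g q : ℂ[X]}
    (hgq : g * q = poleDenom ξ) {r : RatFunc ℂ} (hr : r ∈ ratSpace ξ)
    (hg : ∀ z : ℂ, g.eval z = 0 → r.denom.eval z ≠ 0) :
    ∃ p : ℂ[X], p.degree < ((k - g.natDegree : ℕ) : WithBot ℕ) ∧
      r = algebraMap ℂ[X] (RatFunc ℂ) p / algebraMap ℂ[X] (RatFunc ℂ) q := by
  obtain ⟨P, hP, hrP⟩ := hr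
  have h0 := poleDenom_ne_zero ξ
  rw [← hgq] at h0 hrP
  have hg0 := left_ne_zero_of_mul h0
  have hq0 := right_ne_zero_of_mul h0
  have hcop : IsCoprime r.denom g := by
    rw [Polynomial.isCoprime_iff_aeval_ne_zero_of_isAlgClosed ℂ ℂ]
    intro z
    simp only [coe_aeval_eq_eval]
    by_cases hz : g.eval z = 0
    · exact .inl (hg z hz)
    · exact .inr hz
  have hdvd : r.denom ∣ q := hcop.dvd_of_dvd_mul_left (hrP ▸ RatFunc.denom_div_dvd P (g * q))
  obtain ⟨c, hc⟩ := hdvd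
  have hrp : r = algebraMap ℂ[X] (RatFunc ℂ) (r.num * c) / algebraMap ℂ[X] (RatFunc ℂ) q := by
    rw [← RatFunc.num_mul_eq_mul_denom_iff hq0]
    linear_combination r.num * hc
  refine ⟨r.num * c, ?_, hrp⟩
  have hcross := (RatFunc.num_mul_eq_mul_denom_iff h0).mpr hrP
  have hPeq : P = g * (r.num * c) := by
    have hden : r.denom ≠ 0 := r.denom_ne_zero
    refine mul_right_cancel₀ hden ?_
    rw [← hcross]
    linear_combination r.num * g * hc
  by_cases hp0 : r.num * c = 0
  · rw [hp0, degree_zero]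
    exact WithBot.bot_lt_coe _
  · rw [hPeq, degree_mul, degree_eq_natDegree hg0, degree_eq_natDegree hp0] at hP
    rw [degree_eq_natDegree hp0]
    have : g.natDegree + (r.num * c).natDegree < k := by exact_mod_cast hP
    exact_mod_cast (by omega : (r.num * c).natDegree < k - g.natDegree)

/-- A finite distance would bound `r` near its pole `y`, say by `B`. Then `|num| ≤ B |denom|` passes
to the limit at `y` and makes the numerator vanish too, against coprimality. -/
theorem supDist_eq_top {f : ℝ → ℝ} {a b : ℝ} (hab : a < b) (hf : ContinuousOn f (Set.Icc a b))
    {r : RatFunc ℂ} {y : ℝ} (hy : y ∈ Set.Icc a b) (hr : r.denom.eval (y : ℂ) = 0) :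
    supDist f r a b = ⊤ := by
  by_contra htop
  obtain ⟨M, hM⟩ := isCompact_Icc.exists_bound_of_continuousOn hf
  have hbound : ∀ x ∈ Set.Icc a b, ‖evalAt r x‖ ≤ M + (supDist f r a b).toReal := by
    intro x hx
    have h1 : ‖(f x : ℂ) - evalAt r x‖ₑ ≤ supDist f r a b :=
      le_iSup₂ (f := fun x (_ : x ∈ Set.Icc a b) => ‖(f x : ℂ) - evalAt r x‖ₑ) x hx
    have h2 : ‖(f x : ℂ) - evalAt r x‖ ≤ (supDist f r a b).toReal := by
      have := ENNReal.toReal_mono htop h1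
      rwa [toReal_enorm] at this
    have h3 : ‖(f x : ℂ)‖ ≤ M := by
      rw [Complex.norm_real]
      exact hM x hx
    calc ‖evalAt r x‖ = ‖(f x : ℂ) - ((f x : ℂ) - evalAt r x)‖ := by rw [sub_sub_cancel]
      _ ≤ _ := (norm_sub_le _ _).trans (add_le_add h3 h2)
  set B := M + (supDist f r a b).toReal
  have hfin : {x : ℝ | r.denom.eval (x : ℂ) = 0}.Finite := by
    have : (r.denom.rootSet ℂ).Finite := r.denom.rootSet_finite ℂ
    refine (this.preimage (Complex.ofReal_injective.injOn)).subset fun x hx => ?_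
    rw [Set.mem_preimage, mem_rootSet]
    exact ⟨r.denom_ne_zero, by simpa using hx⟩
  have hne : ∀ᶠ x : ℝ in nhdsWithin y {y}ᶜ, r.denom.eval (x : ℂ) ≠ 0 := by
    have h := (hfin.sdiff (t := ({y} : Set ℝ))).isClosed.isOpen_compl.mem_nhds (x := y) (by simp)
    rw [eventually_nhdsWithin_iff]
    filter_upwards [h] with x hx hxy h0
    exact hx ⟨h0, hxy⟩
  -- Here `a < b` enters: `y` must be a limit of other points of the interval.
  have hacc : AccPt y (Filter.principal (Set.Icc a b)) :=
    isPreconnected_Icc.preperfect_of_nontrivial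
      ⟨a, Set.left_mem_Icc.mpr hab.le, b, Set.right_mem_Icc.mpr hab.le, hab.ne⟩ y hy
  have : (nhdsWithin y {y}ᶜ ⊓ Filter.principal (Set.Icc a b)).NeBot := hacc
  have hcont : ∀ s : ℂ[X], Filter.Tendsto (fun x : ℝ => ‖s.eval (x : ℂ)‖)
      (nhdsWithin y {y}ᶜ ⊓ Filter.principal (Set.Icc a b)) (nhds ‖s.eval (y : ℂ)‖) := fun s =>
    ((s.continuous.comp Complex.continuous_ofReal).norm.tendsto y).mono_left
      (inf_le_left.trans nhdsWithin_le_nhds)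
  have hle : ‖r.num.eval (y : ℂ)‖ ≤ B * ‖r.denom.eval (y : ℂ)‖ := by
    refine le_of_tendsto_of_tendsto (hcont r.num) ((hcont r.denom).const_mul B) ?_
    filter_upwards [hne.filter_mono inf_le_left,
      Filter.mem_inf_of_right (Filter.mem_principal_self _)] with x hx0 hx
    have := hbound x hx
    rw [evalAt, RatFunc.eval, eval₂_id, eval₂_id, norm_div,
      div_le_iff₀ (norm_pos_iff.mpr hx0)] at this
    exact this
  rw [hr, norm_zero, mul_zero, norm_le_zero_iff] at hle
  obtain ⟨u, v, huv⟩ := r.isCoprime_num_denom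
  have := congrArg (eval (y : ℂ)) huv
  simp [hle, hr] at this

/-- Best approximations by elements of a finite-dimensional space exist. -/
theorem exists_best_approximation {V E : Type*} [AddCommGroup V] [Module ℂ V]
    [FiniteDimensional ℂ V] [NormedAddCommGroup E] [NormedSpace ℂ E] (φ : V →ₗ[ℂ] E) (F : E) :
    ∃ v, ∀ w, ‖F - φ v‖ ≤ ‖F - φ w‖ := by
  -- On the finite-dimensional range the distance to `F` is continuous and coercive, hence attains
  -- its minimum.
  have : ProperSpace (LinearMap.range φ) := FiniteDimensional.proper ℂ _
  obtain ⟨⟨-, v, rfl⟩, hv⟩ := Continuous.exists_forall_le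
    (f := fun y : LinearMap.range φ => ‖F - y‖) (by fun_prop) (by
      refine Filter.tendsto_atTop_mono (f := fun y : LinearMap.range φ => -‖F‖ + ‖y‖) (fun y => ?_)
        (Filter.tendsto_atTop_add_const_left _ _ tendsto_norm_cocompact_atTop)
      have := norm_sub_norm_le (y : E) F
      rw [norm_sub_rev] at this
      rw [Submodule.coe_norm]
      linarith)
  exact ⟨v, fun w => hv ⟨φ w, w, rfl⟩⟩

/-- The functions `p / q` on an interval, depending linearly on `p`. -/
noncomputable def divMap (κ : ℕ) (a b : ℝ) (q : ℂ[X])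
    (hq : ∀ x ∈ Set.Icc a b, q.eval (x : ℂ) ≠ 0) :
    degreeLT ℂ κ →ₗ[ℂ] C(Set.Icc a b, ℂ) where
  toFun p := ⟨fun x => (p : ℂ[X]).eval ((x : ℝ) : ℂ) / q.eval ((x : ℝ) : ℂ), by
    refine Continuous.div ?_ ?_ fun x => hq x x.2
    · exact (p : ℂ[X]).continuous.comp (Complex.continuous_ofReal.comp continuous_subtype_val)
    · exact q.continuous.comp (Complex.continuous_ofReal.comp continuous_subtype_val)⟩
  map_add' p p' := by
    ext x
    simp [add_div]
  map_smul' c p := by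
    ext x
    simp [mul_div_assoc]

theorem supDist_div_eq {f : ℝ → ℝ} {a b : ℝ} {κ : ℕ} {q : ℂ[X]}
    (hq : ∀ x ∈ Set.Icc a b, q.eval (x : ℂ) ≠ 0) (F : C(Set.Icc a b, ℂ))
    (hF : ∀ x, F x = (f x : ℂ)) (p : degreeLT ℂ κ) :
    supDist f (algebraMap ℂ[X] (RatFunc ℂ) p / algebraMap ℂ[X] (RatFunc ℂ) q) a b =
      ‖F - divMap κ a b q hq p‖ₑ := by
  rw [ContinuousMap.enorm_eq_iSup_enorm, supDist, iSup_subtype']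
  refine iSup_congr fun x => ?_
  rw [evalAt_div (hq x x.2), ContinuousMap.sub_apply, hF]
  rfl

/-- The minimal distance of `f` from `ratSpace ξ` is attained, by a quotient without poles in the
interval. -/
theorem exists_isLeast_supDist {k : ℕ} {ξ : Fin k → OnePoint ℂ} {a b : ℝ} (hab : a ≤ b)
    {f : ℝ → ℝ} (hf : ContinuousOn f (Set.Icc a b)) {g q : ℂ[X]} (hgq : g * q = poleDenom ξ)
    (hg : ∀ z : ℂ, g.eval z = 0 → ∃ x ∈ Set.Icc a b, z = (x : ℂ))
    (hq : ∀ x ∈ Set.Icc a b, q.eval (x : ℂ) ≠ 0) (hgk : g.natDegree ≤ k) :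
    ∃ p : ℂ[X], p.degree < ((k - g.natDegree : ℕ) : WithBot ℕ) ∧ ∃ ε : ℝ, 0 ≤ ε ∧
      IsLeast ((fun r => supDist f r a b) '' ratSpace ξ) (ENNReal.ofReal ε) ∧
      ∀ x ∈ Set.Icc a b, ‖(f x : ℂ) - p.eval (x : ℂ) / q.eval (x : ℂ)‖ ≤ ε := by
  let F : C(Set.Icc a b, ℂ) :=
    ⟨fun x => (f x : ℂ), Complex.continuous_ofReal.comp hf.domRestrict⟩
  obtain ⟨p, hp⟩ := exists_best_approximation (divMap (k - g.natDegree) a b q hq) F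
  have hsup := supDist_div_eq (f := f) hq F (fun _ => rfl) (κ := k - g.natDegree)
  have hmin : ∀ p', ‖F - divMap (k - g.natDegree) a b q hq p‖ₑ ≤
      ‖F - divMap (k - g.natDegree) a b q hq p'‖ₑ := fun p' => by
    rw [← ofReal_norm, ← ofReal_norm]
    exact ENNReal.ofReal_le_ofReal (hp p')
  refine ⟨p, mem_degreeLT.mp p.2, ‖F - divMap (k - g.natDegree) a b q hq p‖, norm_nonneg _,
    ⟨⟨_, div_mem_ratSpace hgq (by omega) (mem_degreeLT.mp p.2), ?_⟩, ?_⟩, fun x hx => ?_⟩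
  · rw [ofReal_norm]
    exact hsup p
  · rw [ofReal_norm]
    rintro _ ⟨r, hr, rfl⟩
    by_cases hpole : ∃ y ∈ Set.Icc a b, r.denom.eval (y : ℂ) = 0
    · obtain ⟨y, hy, hy0⟩ := hpole
      rcases hab.lt_or_eq with hlt | rfl
      · simp only [supDist_eq_top hlt hf hy hy0, le_top]
      -- For `a = b` a pole at the only point evaluates to the default value `0`, so `r` is no
      -- better than the zero numerator.
      · refine (hmin 0).trans_eq ?_
        rw [← hsup]
        refine iSup_congr fun x => iSup_congr fun hx => ?_
        rw [Set.Icc_self, Set.mem_singleton_iff] at hx hy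
        subst hx
        subst hy
        rw [evalAt, evalAt, RatFunc.eval_eq_zero_of_eval₂_denom_eq_zero (x := r) (by
          rwa [eval₂_id])]
        simp
    · push Not at hpole
      obtain ⟨p', hp', rfl⟩ := exists_eq_div_of_denom_ne_zero hgq hr fun z hz => by
        obtain ⟨x, hx, rfl⟩ := hg z hz
        exact hpole x hx
      exact (hmin ⟨p', mem_degreeLT.mpr hp'⟩).trans_eq (hsup ⟨p', mem_degreeLT.mpr hp'⟩).symm
  · exact (F - divMap (k - g.natDegree) a b q hq p).norm_coe_le_norm ⟨x, hx⟩

/-- The real part of a complex polynomial on the real line is a real polynomial. -/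
theorem exists_re_polynomial {κ : ℕ} {p : ℂ[X]} (hp : p.degree < (κ : WithBot ℕ)) :
    ∃ P : ℝ[X], P.natDegree ≤ κ ∧ ∀ x : ℝ, P.eval x = (p.eval (x : ℂ)).re := by
  refine ⟨∑ i ∈ Finset.range κ, C (p.coeff i).re * X ^ i, ?_, fun x => ?_⟩
  · refine natDegree_sum_le_of_forall_le _ _ fun i hi => ?_
    exact (natDegree_C_mul_X_pow_le _ _).trans (Finset.mem_range.mp hi).le
  · have hsum : p.eval (x : ℂ) = ∑ i ∈ Finset.range κ, p.coeff i * (x : ℂ) ^ i := by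
      by_cases h0 : p = 0
      · simp [h0]
      · exact eval_eq_sum_range' ((natDegree_lt_iff_degree_lt h0).mpr hp) _
    rw [hsum, Complex.re_sum, eval_finsetSum]
    refine Finset.sum_congr rfl fun i _ => ?_
    rw [eval_mul, eval_C, eval_pow, eval_X, ← Complex.ofReal_pow, Complex.re_mul_ofReal]

end Approximation

theorem eq_of_norm2_sub_eq_zero {n : ℕ} {M N : Matrix (Fin n) (Fin n) ℝ} (h : norm2 (M - N) = 0) :
    N = M := by
  rw [norm2, ← ofReal_norm, ENNReal.ofReal_eq_zero, norm_le_zero_iff,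
    EmbeddingLike.map_eq_zero_iff, sub_eq_zero] at h
  exact h.symm

end HSSFun

/-! ### The error bound and exactness. -/

open HSSFun in
theorem mainTheorem1 {n L : ℕ} (T : ClusterTree n L) (ρ : ℕ)
    (A : Matrix (Fin n) (Fin n) ℝ) (hsymm : A.IsSymm) (hHSS : T.IsHSS ρ A)
    (t : TelDecomp L T.leafSize) (ht : t.IsSymmetric) (hstd : t.IsStandard)
    (htA : T.matrixOf t = A)
    {k : ℕ} (ξ : Fin k → OnePoint ℂ) (hξ : ConjClosed ξ)
    (a b : ℝ) (hab : a ≤ b) (hspec : spectrum ℝ A ⊆ Set.Icc a b)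
    (f : ℝ → ℝ) (hf : AnalyticOnNhd ℝ f (Set.Icc a b))
    (out : TelDecomp L T.leafSize) (hout : AlgorithmRun f ξ t out) :
    (∃ μ : ENNReal, IsLeast ((fun r => supDist f r a b) '' ratSpace ξ) μ ∧
      norm2 (cfc f A - T.matrixOf out) ≤ 4 * (L : ENNReal) * μ) ∧
    ((∃ r ∈ ratSpace ξ, ∀ x ∈ Set.Icc a b, (f x : ℂ) = evalAt r x) → T.matrixOf out = cfc f A) := by
  subst htA
  obtain ⟨Q, hQ⟩ := exists_real_poleDenom hξ
  have hQ0 : Q ≠ 0 := by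
    rintro rfl
    exact poleDenom_ne_zero ξ (by rw [← hQ, Polynomial.map_zero])
  obtain ⟨g, q, rfl, hq, hg⟩ := exists_factor_roots (Set.Icc a b) Q hQ0
  -- This makes `deg q ≤ κ` for `κ = k - deg g`, as the exactness lemmas require.
  have hdeg : g.natDegree + q.natDegree ≤ k := by
    rw [← natDegree_mul (left_ne_zero_of_mul hQ0) (right_ne_zero_of_mul hQ0),
      ← natDegree_map (algebraMap ℝ ℂ), hQ]
    exact natDegree_poleDenom_le ξ
  have hqeval : ∀ x : ℝ, (q.map (algebraMap ℝ ℂ)).eval (x : ℂ) = ((q.eval x : ℝ) : ℂ) :=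
    fun x => eval_map_apply (algebraMap ℝ ℂ) x
  obtain ⟨p, hp, ε, hε, hleast, hpε⟩ := exists_isLeast_supDist hab hf.continuousOn
    ((Polynomial.map_mul (algebraMap ℝ ℂ)).symm.trans hQ) hg
    (fun x hx => by rw [hqeval]; exact Complex.ofReal_ne_zero.mpr (hq x hx))
    (by rw [natDegree_map]; omega)
  rw [natDegree_map] at hp
  obtain ⟨P, hPdeg, hP⟩ := exists_re_polynomial hp
  have hbound := norm2_cfc_sub_matrixOf_le (P := P) hQ (κ := k - g.natDegree) (by omega) hPdeg
    (by omega) hq hε (fun x hx => by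
      -- Since `f` and `q` are real on the line, replacing `p` by its real part does not increase
      -- the error.
      refine le_trans ?_ (hpε x hx)
      rw [hP, hqeval, ← Complex.div_ofReal_re, ← Complex.ofReal_re (f x), ← Complex.sub_re,
        Complex.ofReal_re]
      exact Complex.abs_re_le_norm _) T hout hstd hsymm hspec
  refine ⟨⟨_, hleast, hbound⟩, ?_⟩
  rintro ⟨r, hr, hfr⟩
  -- An element of the space that agrees with `f` has distance `0`, so the minimum is `0`.
  have hzero : ENNReal.ofReal ε = 0 := by
    refine le_antisymm ((hleast.2 ⟨r, hr, rfl⟩).trans ?_) zero_le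
    refine iSup₂_le fun x hx => ?_
    rw [hfr x hx, sub_self, enorm_zero]
  rw [hzero, mul_zero] at hbound
  exact eq_of_norm2_sub_eq_zero (le_antisymm hbound zero_le)
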